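/- Let $s\ge 2$ and let $X$ be a smooth manifold of dimension $2(s+1)$ with a (pointwise) rank two $s$-Kähler structure, i.e. a Riemannian metric and smooth two-forms $\omega_{jk}$ ($j,k\in\{0,\dots,s\}$) such that at every $p\in X$ there is an adapted coframe: an orthonormal basis $v_{ij}$ ($i=1,2$, $j=0,\dots,s$) of $T_p^*X$ with $\omega_{jk}=v_{1j}\wedge v_{1k}+v_{2j}\wedge v_{2k}$ for all $j,k$. Fix $p$ and an adapted coframe at $p$. Let $J$ be the derivation of $\bigwedge^*T^*_pX$ with $Jv_{1j}=v_{2j}$, $Jv_{2j}=-v_{1j}$, and let $\Omega=v_{10}\wedge v_{20}\wedge\cdots\wedge v_{1s}\wedge v_{2s}$. Let $L_{jk}$ ($j\ne k$) and $V_j$ be the operators on $\bigwedge^*T^*_pX$ of exterior multiplication by $\omega_{jk}$ and by $v_{1j}\wedge v_{2j}$, and $\Lambda_{jk}=L_{jk}^*$, $A_j=V_j^*$ their adjoints for the induced metric. Let $\mathcal L^s_{\mathbb R}$ be the real Lie algebra generated by all $L_{jk},V_j,\Lambda_{jk},A_j$, let $\mathcal L^s_{\mathbb C}=\mathcal L^s_{\mathbb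 R}\otimes\mathbb C$, acting on $\bigwedge^*_{\mathbb C}T^*_pX=\bigwedge^*T_p^*X\otimes\mathbb C$, and let $\mathbf u\mathcal L^s$ be the real Lie algebra of operators on $\bigwedge^*_{\mathbb C}T^*_pX$ generated by all $iL_{jk},iV_j,i\Lambda_{jk},iA_j$. (These are the fibres at $p$ of the corresponding Lie algebra bundles.) With $(\cdot,\cdot)$ the Hermitian metric induced on $\bigwedge^*_{\mathbb C}T^*_pX$, let $\langle\cdot,\cdot\rangle$ be the sesquilinear form (linear in the first argument) given for homogeneous $\alpha,\beta$ by $$\langle\alpha,\beta\rangle=i^{\deg\alpha\,\deg\beta}\,(\alpha\wedge\overline\beta,\Omega).$$ Let $\mathcal I_{-s}=\{\alpha\in\bigwedge^*_{\mathbb C}T^*_pX : J\alpha=-is\,\alpha\}$. Then: 1. $\mathbf u\mathcal L^s$ is a real form of $\mathcal L^s_{\mathbb C}$: $\mathcal L^s_{\mathbb C}=\mathbf u\mathcal L^s\oplus i\,\mathbf u\mathcal L^s$. 2. The form $\langle\cdot,\cdot\rangle$ is Hermitian, and $\mathbf u\mathcal L^s$ is exactly the set of $\varphi\in\mathcal L^s_{\mathbb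 C}$ that preserve it, i.e. satisfy $\langle\varphi\alpha,\beta\rangle+\langle\alpha,\varphi\beta\rangle=0$ for all $\alpha,\beta\in\bigwedge^*_{\mathbb C}T^*_pX$. 3. The restriction of $\langle\cdot,\cdot\rangle$ to $\mathcal I_{-s}$ is nondegenerate of signature $(s+1,s+1)$. 4. $\mathbf u\mathcal L^s$ is isomorphic, as a real Lie algebra, to $\mathfrak{su}(s+1,s+1)$. -/

import Mathlib

open scoped TensorProduct Manifold ContDiff Bundle
open Bundle

attribute [local instance] LieRing.ofAssociativeRing

set_option linter.unusedSectionVars false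

noncomputable section

namespace SKaehler

/-! ## Exterior algebra of a Euclidean space `M` (later: the cotangent space at a point) -/

section Linear

variable (M : Type*) [NormedAddCommGroup M] [InnerProductSpace ℝ M] [FiniteDimensional ℝ M]

/-- Real forms: the exterior algebra of the space `M` of covectors. -/
abbrev RForm : Type _ := ExteriorAlgebra ℝ M

/-- Complex forms: the complexification of the space of real forms. -/
abbrev CForm : Type _ := ℂ ⊗[ℝ] ExteriorAlgebra ℝ M

variable {M}

/-- The component of degree `k` of a real form, as an element of `⋀^k M`. -/
def component (k : ℕ) : RForm M →ₗ[ℝ] ⋀[ℝ]^k M :=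
  DirectSum.component ℝ ℕ (fun i => ⋀[ℝ]^i M) k ∘ₗ
    (DirectSum.decomposeLinearEquiv (fun i => ⋀[ℝ]^i M)).toLinearMap

/-- The component of degree `k` of a complex form. -/
def ccomponent (k : ℕ) : CForm M →ₗ[ℂ] CForm M :=
  ((⋀[ℝ]^k M).subtype ∘ₗ component k).baseChange ℂ

/-- The metric on real forms induced by the metric of `M`: forms of different degrees are
orthogonal, and `(a₁ ∧ ⋯ ∧ aₖ, b₁ ∧ ⋯ ∧ bₖ) = det (aᵢ, bⱼ)`. -/
def metric : LinearMap.BilinForm ℝ (RForm M) :=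
  ∑ k ∈ Finset.range (Module.finrank ℝ M + 1),
    (innerₗ (⋀[ℝ]^k M)).compl₁₂ (component k) (component k)

theorem component_eq_zero_of_lt {k : ℕ} (hk : Module.finrank ℝ M < k) (x : RForm M) :
    component k x = 0 := by
  have b := (Module.finBasis ℝ M).exteriorPower k
  have h : IsEmpty (Set.powersetCard (Fin (Module.finrank ℝ M)) k) := by
    constructor
    rintro ⟨t, ht⟩
    have h1 : t.card = k := ht
    have h2 := t.card_le_univ
    rw [Fintype.card_fin] at h2
    omega
  exact b.ext_elem fun i => h.elim i

theorem metric_posDef {x : RForm M} (hx : metric x x = 0) : x = 0 := by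
  have h0 : ∀ k, component k x = 0 := by
    intro k
    by_cases hk : k ∈ Finset.range (Module.finrank ℝ M + 1)
    · have h1 : ∑ k ∈ Finset.range (Module.finrank ℝ M + 1),
          inner ℝ (component k x) (component k x) = 0 := by
        simpa [metric, LinearMap.sum_apply] using hx
      have h2 := (Finset.sum_eq_zero_iff_of_nonneg
        (fun i _ => real_inner_self_nonneg)).1 h1 k hk
      exact inner_self_eq_zero.1 h2
    · exact component_eq_zero_of_lt (by simpa using hk) x
  apply (DirectSum.decomposeLinearEquiv (R := ℝ) (fun i => ⋀[ℝ]^i M)).injective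
  rw [map_zero]
  exact DFinsupp.ext h0

instance : FiniteDimensional ℝ (RForm M) :=
  Module.Finite.of_basis (Module.finBasis ℝ M).ExteriorAlgebra

theorem metric_isSymm : (metric (M := M)).IsSymm := by
  constructor
  intro x y
  simp [metric, LinearMap.sum_apply, real_inner_comm]

theorem metric_nondegenerate : (metric (M := M)).Nondegenerate := by
  constructor
  · intro x hx
    exact metric_posDef (hx x)
  · intro x hx
    exact metric_posDef (hx x)

/-- The adjoint `T^*` of an operator on real forms with respect to the metric. -/
def adj (T : Module.End ℝ (RForm M)) : Module.End ℝ (RForm M) :=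
  LinearMap.BilinForm.leftAdjointOfNondegenerate metric metric_nondegenerate T

theorem metric_adj (T : Module.End ℝ (RForm M)) (x y : RForm M) :
    metric (adj T x) y = metric x (T y) :=
  LinearMap.BilinForm.isAdjointPairLeftAdjointOfNondegenerate metric metric_nondegenerate T x y

/-- Conjugation of complex forms. -/
def conj : CForm M →ₗ⋆[ℂ] CForm M where
  toFun := LinearMap.rTensor (RForm M) Complex.conjAe.toLinearMap
  map_add' := map_add _
  map_smul' c x := by
    induction x using TensorProduct.induction_on with
    | zero => simp
    | tmul z a => simp [TensorProduct.smul_tmul']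
    | add x y hx hy => rw [smul_add, map_add, hx, hy, map_add, smul_add]

/-- The Hermitian metric on complex forms induced by the metric on real forms:
`(z ⊗ a, w ⊗ b) = z * conj w * (a, b)`. -/
def hermitianMetric : CForm M →ₗ[ℂ] CForm M →ₗ⋆[ℂ] ℂ :=
  (metric.baseChange ℂ).compl₂ conj

/-! ## Operators attached to an adapted coframe

`v (i, j)` is the covector `v_{ij}`, where `i` runs over two values and `j` over `0, …, s`. -/

variable {s : ℕ} (v : OrthonormalBasis (Fin 2 × Fin (s + 1)) ℝ M)

/-- `v_{ij}` as a form of degree one. -/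
def cov (i : Fin 2) (j : Fin (s + 1)) : RForm M := ExteriorAlgebra.ι ℝ (v (i, j))

/-- The wedge operator `E_{ij}`. -/
def E (i : Fin 2) (j : Fin (s + 1)) : Module.End ℝ (RForm M) :=
  LinearMap.mulLeft ℝ (cov v i j)

/-- The contraction operator `I_{ij}` with the vector dual to `v_{ij}`. -/
def I (i : Fin 2) (j : Fin (s + 1)) : Module.End ℝ (RForm M) :=
  CliffordAlgebra.contractLeft (v.toBasis.coord (i, j))

/-- `L_{jk}`: wedge with the two-form `ω_{jk} = ∑ i, v_{ij} ∧ v_{ik}`. -/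
def L (j k : Fin (s + 1)) : Module.End ℝ (RForm M) :=
  LinearMap.mulLeft ℝ (∑ i, cov v i j * cov v i k)

/-- `V_j`: wedge with the volume form `v_{1j} ∧ v_{2j}` of the distribution `W_j`. -/
def V (j : Fin (s + 1)) : Module.End ℝ (RForm M) :=
  LinearMap.mulLeft ℝ (cov v 0 j * cov v 1 j)

/-- The derivation `J` with `J v_{1j} = v_{2j}` and `J v_{2j} = - v_{1j}`
(see `J_cov_zero`, `J_cov_one`, `J_mul`). -/
def J : Module.End ℝ (RForm M) := ∑ j, (E v 1 j * I v 0 j - E v 0 j * I v 1 j)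

/-- The generators `L_{jk}, V_j, Λ_{jk} = L_{jk}^*, A_j = V_j^*`. -/
def generators : Set (Module.End ℝ (RForm M)) :=
  {T | (∃ j k, j ≠ k ∧ (T = L v j k ∨ T = adj (L v j k))) ∨
       (∃ j, T = V v j ∨ T = adj (V v j))}

/-- The fibre of `𝓛^s_ℝ`. -/
def LR : LieSubalgebra ℝ (Module.End ℝ (RForm M)) :=
  LieSubalgebra.lieSpan ℝ _ (generators v)

/-- The fibre of `𝓛^s_ℂ = 𝓛^s_ℝ ⊗ ℂ`, acting on complex forms. -/
def LC : LieSubalgebra ℂ (Module.End ℂ (CForm M)) :=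
  { Submodule.span ℂ ((fun T : Module.End ℝ (RForm M) => T.baseChange ℂ) '' (LR v)) with
    lie_mem' := by
      intro x y hx hy
      change x ∈ Submodule.span ℂ _ at hx
      change y ∈ Submodule.span ℂ _ at hy
      change ⁅x, y⁆ ∈ Submodule.span ℂ _
      induction hx, hy using Submodule.span_induction₂ with
      | mem_mem x y hx hy =>
        obtain ⟨S, hS, rfl⟩ := hx
        obtain ⟨T, hT, rfl⟩ := hy
        refine Submodule.subset_span ⟨⁅S, T⁆, (LR v).lie_mem hS hT, ?_⟩
        simp only [Ring.lie_def, LinearMap.baseChange_sub, LinearMap.baseChange_mul]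
      | zero_left y hy => simp
      | zero_right x hx => simp
      | add_left x y z hx hy hz h1 h2 => rw [add_lie]; exact add_mem h1 h2
      | add_right x y z hx hy hz h1 h2 => rw [lie_add]; exact add_mem h1 h2
      | smul_left r x y hx hy h => rw [smul_lie]; exact Submodule.smul_mem _ _ h
      | smul_right r x y hx hy h => rw [lie_smul]; exact Submodule.smul_mem _ _ h }

/-- The fibre of `𝐮𝓛^s`: the real Lie algebra of operators on complex forms generated by
`i L_{jk}, i V_j, i Λ_{jk}, i A_j`. -/
def uL : LieSubalgebra ℝ (Module.End ℂ (CForm M)) :=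
  LieSubalgebra.lieSpan ℝ _
    ((fun T : Module.End ℝ (RForm M) => Complex.I • T.baseChange ℂ) '' generators v)

/-- The volume form `Ω = v_{10} ∧ v_{20} ∧ v_{11} ∧ v_{21} ∧ ⋯ ∧ v_{1s} ∧ v_{2s}`. -/
def Ω : CForm M :=
  1 ⊗ₜ[ℝ] (List.ofFn fun j : Fin (s + 1) => cov v 0 j * cov v 1 j).prod

/-- The natural Hermitian form, `⟨α, β⟩ = i ^ (deg α * deg β) * (α ∧ conj β, Ω)` for homogeneous
`α` and `β`, extended sesquilinearly to all forms. -/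
def form : CForm M →ₗ[ℂ] CForm M →ₗ⋆[ℂ] ℂ :=
  ∑ a ∈ Finset.range (Module.finrank ℝ M + 1), ∑ b ∈ Finset.range (Module.finrank ℝ M + 1),
    LinearMap.mk₂'ₛₗ (RingHom.id ℂ) (starRingEnd ℂ)
      (fun α β : CForm M =>
        Complex.I ^ (a * b) * hermitianMetric (ccomponent a α * conj (ccomponent b β)) (Ω v))
      (by intros; simp [add_mul, mul_add])
      (by intros; simp [smul_mul_assoc]; ring)
      (by intros; simp [mul_add])
      (by intros; simp [mul_smul_comm]; ring)

/-- `𝓘_{-s}`: the complex forms of `J`-weight `-s`, on which `J` acts as `-s * i`. -/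
def weightSpace : Submodule ℂ (CForm M) :=
  Module.End.eigenspace ((J v).baseChange ℂ) (-(s : ℂ) * Complex.I)

theorem wedge_contract_mul (m : M) (d : Module.Dual ℝ M) (x y : RForm M) :
    ExteriorAlgebra.ι ℝ m * CliffordAlgebra.contractLeft d (x * y) =
      ExteriorAlgebra.ι ℝ m * CliffordAlgebra.contractLeft d x * y +
        x * (ExteriorAlgebra.ι ℝ m * CliffordAlgebra.contractLeft d y) := by
  induction x using CliffordAlgebra.left_induction with
  | algebraMap r =>
    rw [CliffordAlgebra.contractLeft_algebraMap_mul, CliffordAlgebra.contractLeft_algebraMap,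
      mul_zero, zero_mul, zero_add, ← mul_assoc, ← mul_assoc, Algebra.commutes]
  | add x z hx hz => rw [add_mul, map_add, mul_add, hx, hz, map_add]; noncomm_ring
  | ι_mul x n hx =>
    have h : ExteriorAlgebra.ι ℝ m * CliffordAlgebra.ι 0 n =
        -(CliffordAlgebra.ι 0 n * ExteriorAlgebra.ι ℝ m) :=
      eq_neg_of_add_eq_zero_left (ExteriorAlgebra.ι_add_mul_swap m n)
    rw [mul_assoc, CliffordAlgebra.contractLeft_ι_mul, CliffordAlgebra.contractLeft_ι_mul,
      mul_sub, mul_sub, ← mul_assoc _ (CliffordAlgebra.ι 0 n) _,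
      ← mul_assoc _ (CliffordAlgebra.ι 0 n) _, h, neg_mul, neg_mul, mul_assoc, hx]
    simp only [mul_smul_comm, smul_mul_assoc, sub_mul, mul_add, neg_mul, mul_assoc]
    abel

theorem J_mul (x y : RForm M) : J v (x * y) = J v x * y + x * J v y := by
  simp only [J, LinearMap.sum_apply, LinearMap.sub_apply, Module.End.mul_apply, E, I, cov,
    LinearMap.mulLeft_apply, wedge_contract_mul, Finset.sum_mul, Finset.mul_sum,
    ← Finset.sum_add_distrib]
  refine Finset.sum_congr rfl fun j _ => ?_
  noncomm_ring

theorem I_cov (i k : Fin 2) (j l : Fin (s + 1)) :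
    I v i j (cov v k l) = if (k, l) = (i, j) then 1 else 0 := by
  simp only [I, cov]
  have h := CliffordAlgebra.contractLeft_ι (Q := (0 : QuadraticForm ℝ M))
    (v.toBasis.coord (i, j)) (v (k, l))
  refine h.trans ?_
  have h' : v.toBasis.coord (i, j) (v (k, l)) = if (k, l) = (i, j) then 1 else 0 := by
    rw [← v.coe_toBasis, Module.Basis.coord_apply, Module.Basis.repr_self,
      Finsupp.single_apply]
  rw [h']
  split_ifs <;> simp

theorem J_cov_zero (j : Fin (s + 1)) : J v (cov v 0 j) = cov v 1 j := by
  simp [J, LinearMap.sum_apply, I_cov, E]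

theorem J_cov_one (j : Fin (s + 1)) : J v (cov v 1 j) = - cov v 0 j := by
  simp [J, LinearMap.sum_apply, I_cov, E]

end Linear

/-! ## Linear algebra notions -/

section General

variable {W : Type*} [AddCommGroup W] [Module ℂ W]

/-- The operator `φ` preserves the sesquilinear form `h` (infinitesimally). -/
def Preserves (h : W →ₗ[ℂ] W →ₗ⋆[ℂ] ℂ) (φ : Module.End ℂ W) : Prop :=
  ∀ α β, h (φ α) β + h α (φ β) = 0

/-- The restriction of the Hermitian form `h` to the subspace `S` is nondegenerate of
signature `(p, q)`: it is diagonal, with `p` entries `1` and `q` entries `-1`, in some basis. -/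
def HasSignature (h : W →ₗ[ℂ] W →ₗ⋆[ℂ] ℂ) (S : Submodule ℂ W) (p q : ℕ) : Prop :=
  ∃ b : Module.Basis (Fin p ⊕ Fin q) ℂ S, ∀ i j,
    h (b i) (b j) = LieAlgebra.Orthogonal.indefiniteDiagonal (Fin p) (Fin q) ℂ i j

/-- The real Lie subalgebra `u` is a real form of the complex Lie algebra `g`:
`g = u ⊕ i u`. -/
def IsRealForm {A : Type*} [LieRing A] [LieAlgebra ℂ A] [LieAlgebra ℝ A]
    (u : LieSubalgebra ℝ A) (g : LieSubalgebra ℂ A) : Prop :=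
  Submodule.span ℂ (u : Set A) = g.toSubmodule ∧ ∀ x ∈ u, Complex.I • x ∈ u → x = 0

/-- `𝔰𝔲(p, q)`: traceless complex matrices `A` with `A^* D + D A = 0`, where `D` is diagonal with
`p` entries `1` and `q` entries `-1`. -/
def su (p q : ℕ) : LieSubalgebra ℝ (Matrix (Fin p ⊕ Fin q) (Fin p ⊕ Fin q) ℂ) where
  carrier := {A | A.conjTranspose * LieAlgebra.Orthogonal.indefiniteDiagonal (Fin p) (Fin q) ℂ
      + LieAlgebra.Orthogonal.indefiniteDiagonal (Fin p) (Fin q) ℂ * A = 0 ∧ A.trace = 0}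
  add_mem' := by
    rintro A B ⟨hA, hA'⟩ ⟨hB, hB'⟩
    refine ⟨?_, by rw [Matrix.trace_add, hA', hB', add_zero]⟩
    rw [Matrix.conjTranspose_add, add_mul, mul_add, add_add_add_comm, hA, hB, add_zero]
  zero_mem' := by simp
  smul_mem' := by
    rintro c A ⟨hA, hA'⟩
    refine ⟨?_, by rw [Matrix.trace_smul, hA', smul_zero]⟩
    rw [Matrix.conjTranspose_smul, star_trivial, smul_mul_assoc, mul_smul_comm, ← smul_add, hA,
      smul_zero]
  lie_mem' := by
    rintro A B ⟨hA, hA'⟩ ⟨hB, hB'⟩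
    refine ⟨?_, by rw [Ring.lie_def, Matrix.trace_sub, Matrix.trace_mul_comm, sub_self]⟩
    have hA := eq_neg_of_add_eq_zero_left hA
    have hB := eq_neg_of_add_eq_zero_left hB
    rw [Ring.lie_def, Matrix.conjTranspose_sub, Matrix.conjTranspose_mul,
      Matrix.conjTranspose_mul, sub_mul, mul_assoc, mul_assoc, hA, hB, mul_neg, mul_neg,
      ← mul_assoc, ← mul_assoc, hA, hB]
    noncomm_ring

end General

/-! ## Rank two (pointwise) `s`-Kähler manifolds -/

section Manifold

/-- The metric on the dual of a Euclidean space: covectors are paired through the vectors that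
represent them. -/
instance dualInnerProductSpace (T : Type*) [NormedAddCommGroup T] [InnerProductSpace ℝ T]
    [FiniteDimensional ℝ T] : InnerProductSpace ℝ (StrongDual ℝ T) :=
  haveI : CompleteSpace T := FiniteDimensional.complete ℝ T
  { inner φ ψ := inner ℝ ((InnerProductSpace.toDual ℝ T).symm φ)
      ((InnerProductSpace.toDual ℝ T).symm ψ)
    norm_sq_eq_re_inner φ := by
      rw [← norm_sq_eq_re_inner, LinearIsometryEquiv.norm_map]
    conj_inner_symm φ ψ := real_inner_comm _ _
    add_left φ ψ χ := by simp [inner_add_left]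
    smul_left φ ψ r := by simp [inner_smul_left] }

/-- The space of covectors of a Euclidean space. -/
abbrev Covector (T : Type*) [NormedAddCommGroup T] [InnerProductSpace ℝ T] : Type _ :=
  StrongDual ℝ T

variable (s : ℕ) (X : Type*) [TopologicalSpace X]
  [ChartedSpace (EuclideanSpace ℝ (Fin (2 * (s + 1)))) X]

instance (p : X) : FiniteDimensional ℝ (TangentSpace (𝓡 (2 * (s + 1))) p) :=
  inferInstanceAs (FiniteDimensional ℝ (EuclideanSpace ℝ (Fin (2 * (s + 1)))))

variable [IsManifold (𝓡 (2 * (s + 1))) ∞ X]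
  [RiemannianBundle (fun p : X => TangentSpace (𝓡 (2 * (s + 1))) p)]

/-- The cotangent space, with the metric dual to the Riemannian metric. -/
abbrev Cotangent (s : ℕ) {X : Type*} [TopologicalSpace X]
    [ChartedSpace (EuclideanSpace ℝ (Fin (2 * (s + 1)))) X]
    [RiemannianBundle (fun p : X => TangentSpace (𝓡 (2 * (s + 1))) p)] (p : X) : Type :=
  Covector (TangentSpace (𝓡 (2 * (s + 1))) p)

/-- `v_{ij}` is an orthonormal basis of the cotangent space at `p` such that
`ω_{jk} = ∑ i, v_{ij} ∧ v_{ik}` at `p`. -/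
def IsAdapted {s : ℕ} {X : Type*} [TopologicalSpace X]
    [ChartedSpace (EuclideanSpace ℝ (Fin (2 * (s + 1)))) X]
    [RiemannianBundle (fun p : X => TangentSpace (𝓡 (2 * (s + 1))) p)] {p : X}
    (w : Fin (s + 1) → Fin (s + 1) → TangentSpace (𝓡 (2 * (s + 1))) p →L[ℝ]
      TangentSpace (𝓡 (2 * (s + 1))) p →L[ℝ] ℝ)
    (v : OrthonormalBasis (Fin 2 × Fin (s + 1)) ℝ (Cotangent s p)) : Prop :=
  ∀ j k x y, w j k x y = ∑ i, (v (i, j) x * v (i, k) y - v (i, j) y * v (i, k) x)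

/-- A (pointwise) rank two `s`-Kähler structure on a Riemannian manifold of dimension `2 (s + 1)`:
smooth two-forms `ω_{jk}` such that every point has an adapted coframe. -/
structure Structure where
  /-- the forms `ω_{jk}` -/
  form : Fin (s + 1) → Fin (s + 1) → ∀ p : X,
    TangentSpace (𝓡 (2 * (s + 1))) p →L[ℝ] TangentSpace (𝓡 (2 * (s + 1))) p →L[ℝ] ℝ
  smooth : ∀ j k, ContMDiff (𝓡 (2 * (s + 1)))
    ((𝓡 (2 * (s + 1))).prod 𝓘(ℝ, EuclideanSpace ℝ (Fin (2 * (s + 1))) →L[ℝ]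
      EuclideanSpace ℝ (Fin (2 * (s + 1))) →L[ℝ] ℝ)) ∞
    (fun p => Bundle.TotalSpace.mk' (EuclideanSpace ℝ (Fin (2 * (s + 1))) →L[ℝ]
      EuclideanSpace ℝ (Fin (2 * (s + 1))) →L[ℝ] ℝ) p (form j k p))
  exists_adapted : ∀ p, ∃ v : OrthonormalBasis (Fin 2 × Fin (s + 1)) ℝ (Cotangent s p),
    IsAdapted (fun j k => form j k p) v

end Manifold

end SKaehler

end

noncomputable section

namespace SKaehler

/-! ### Exterior multiplication, contraction and the adjoints of the generators -/

section RealForms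

variable {M : Type*} [NormedAddCommGroup M] [InnerProductSpace ℝ M] [FiniteDimensional ℝ M]

/-! Put `z_j = v_{1j} + i v_{2j}`. Take as creation operators `c` wedging with `z_j` and contracting
with the dual of `conj z_j`, and as annihilation operators `d` contracting with the dual of `z_j`
and wedging with `conj z_j`. These `2(s+1)` pairs satisfy the canonical anticommutation relations
(`isCAR`). Hence `rho M = ∑ M_{pq} c_p d_q` is a representation of the matrices of size `2(s+1)`,
and it is faithful, because the anticommutator of `d_p` with `[rho M, c_r]` is the scalar `M_{pr}`.

Since `z_j ∧ conj z_k - z_k ∧ conj z_j = 2 ω_{jk}` and `z_j ∧ conj z_j = -2i v_{1j} ∧ v_{2j}`, the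
generators `iL_{jk}`, `iV_j` are real multiples of images of strictly upper block matrices with
Hermitian block, and `iΛ_{jk}`, `iA_j` of strictly lower ones. For `s ≥ 2` such matrices generate
all block matrices `(P, B; C, -P^*)` with `B`, `C` Hermitian and `tr P` real
(`fromBlocks_mem_of_generators`). This is the special unitary algebra of a split form, and the
Cayley matrix carries it to `𝔰𝔲(s+1, s+1)` (`range_suRep`).

Let `tau` be the coefficient of `Ω`. The Hermitian form is `tau (α * conj β)` up to a phase on odd
forms (`form_eq`). Wedging and contraction pass across `tau (x * y)` at the cost of a sign, so each
generator `T` is symmetric for this pairing, and `iT` is skew for the sesquilinear form. If `x` and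
`ix` both lie in `𝐮𝓛^s`, the image of `x` lies in the radical of the pairing; the radical is stable
under all `c_p`, `d_p` and does not contain `Ω`, so faithfulness forces `x = 0`
(`eq_zero_of_form_eq_zero`). Together with `𝓛^s_ℂ = 𝐮𝓛^s + i 𝐮𝓛^s` this gives the real form and its
characterization by invariance.

For the signature, `iJ = (s+1) - ∑ d_p c_p`, so `𝓘_{-s}` is the eigenspace of the hole number `∑ d_p
c_p` for the value one. The forms killed by all `c_p` are the multiples of `Z = z_0 ∧ ⋯ ∧ z_s`,
hence `𝓘_{-s}` is spanned by the `2(s+1)` forms `d_p Z`. Up to a phase the adjoint of `c_p` is `d`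
at the index with the two summands exchanged; so the `d_p Z` form `s+1` hyperbolic pairs,
nondegenerate because `⟨Z, Z⟩ ≠ 0`. -/

theorem contractLeft_ι_mul (d : Module.Dual ℝ M) (m : M) (x : RForm M) :
    CliffordAlgebra.contractLeft (Q := 0) d (ExteriorAlgebra.ι ℝ m * x) =
      d m • x - ExteriorAlgebra.ι ℝ m * CliffordAlgebra.contractLeft (Q := 0) d x :=
  CliffordAlgebra.contractLeft_ι_mul d m x

theorem contractLeft_one (d : Module.Dual ℝ M) :
    CliffordAlgebra.contractLeft (Q := 0) d (1 : RForm M) = 0 :=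
  CliffordAlgebra.contractLeft_one (d := d) 0

theorem contractLeft_ιMulti (d : Module.Dual ℝ M) (n : ℕ) (b : Fin (n + 1) → M) :
    CliffordAlgebra.contractLeft (Q := 0) d (ExteriorAlgebra.ιMulti ℝ (n + 1) b) =
      ∑ j : Fin (n + 1), ((-1 : ℝ) ^ (j : ℕ) * d (b j)) •
        ExteriorAlgebra.ιMulti ℝ n (fun i => b (j.succAbove i)) := by
  induction n with
  | zero =>
    rw [ExteriorAlgebra.ιMulti_succ_apply, contractLeft_ι_mul]
    simp
  | succ n ih =>
    rw [ExteriorAlgebra.ιMulti_succ_apply, contractLeft_ι_mul, ih]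
    rw [Fin.sum_univ_succ (n := n + 1), sub_eq_add_neg, Finset.mul_sum, ← Finset.sum_neg_distrib]
    congr 1
    · simp [Matrix.vecTail, Function.comp_def]
    · refine Finset.sum_congr rfl fun j _ => ?_
      rw [ExteriorAlgebra.ιMulti_succ_apply, mul_smul_comm, ← neg_smul]
      congr 1
      · simp [Matrix.vecTail, pow_succ]
      · simp [Matrix.vecTail, Function.comp_def]

theorem component_of_mem {n : ℕ} {x : RForm M} (hx : x ∈ ⋀[ℝ]^n M) : component n x = ⟨x, hx⟩ := by
  change DirectSum.component ℝ ℕ (fun i => ⋀[ℝ]^i M) n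
    (DirectSum.decompose (fun i => ⋀[ℝ]^i M) x) = _
  rw [DirectSum.decompose_of_mem (fun i => ⋀[ℝ]^i M) hx]
  exact DirectSum.component.lof_self (M := fun i => ⋀[ℝ]^i M) ℝ n ⟨x, hx⟩

theorem component_of_mem_ne {n k : ℕ} (h : n ≠ k) {x : RForm M} (hx : x ∈ ⋀[ℝ]^n M) :
    component k x = 0 := by
  change DirectSum.component ℝ ℕ (fun i => ⋀[ℝ]^i M) k
    (DirectSum.decompose (fun i => ⋀[ℝ]^i M) x) = _
  rw [DirectSum.decompose_of_mem (fun i => ⋀[ℝ]^i M) hx]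
  exact DirectSum.of_eq_of_ne (β := fun i => ⋀[ℝ]^i M) n k ⟨x, hx⟩ (Ne.symm h)

theorem metric_of_mem_ne {n k : ℕ} (h : n ≠ k) {x y : RForm M} (hx : x ∈ ⋀[ℝ]^n M)
    (hy : y ∈ ⋀[ℝ]^k M) : metric x y = 0 := by
  simp only [metric, LinearMap.sum_apply, LinearMap.compl₁₂_apply]
  refine Finset.sum_eq_zero fun i _ => ?_
  by_cases hi : n = i
  · rw [component_of_mem_ne (by omega : k ≠ i) hy, map_zero]
  · rw [component_of_mem_ne hi hx, map_zero, LinearMap.zero_apply]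

theorem metric_of_mem {n : ℕ} {x y : RForm M} (hx : x ∈ ⋀[ℝ]^n M)
    (hy : y ∈ ⋀[ℝ]^n M) : metric x y = inner ℝ (⟨x, hx⟩ : ⋀[ℝ]^n M) ⟨y, hy⟩ := by
  simp only [metric, LinearMap.sum_apply, LinearMap.compl₁₂_apply]
  by_cases hn : n ∈ Finset.range (Module.finrank ℝ M + 1)
  · rw [Finset.sum_eq_single_of_mem n hn, component_of_mem hx, component_of_mem hy]
    · rfl
    · intro i _ hi
      rw [component_of_mem_ne hi.symm hx, map_zero, LinearMap.zero_apply]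
  -- Degrees above the dimension are outside the range of summation, but forms of such degree
  -- vanish.
  · have h0 : x = 0 := by
      have h1 := component_eq_zero_of_lt (by simpa using hn) x
      rw [component_of_mem hx] at h1
      exact congrArg Subtype.val h1
    subst h0
    simp only [map_zero, LinearMap.zero_apply, Finset.sum_const_zero]
    exact (inner_zero_left _).symm

theorem ιMulti_mem (n : ℕ) (a : Fin n → M) : ExteriorAlgebra.ιMulti ℝ n a ∈ ⋀[ℝ]^n M :=
  ExteriorAlgebra.ιMulti_range ℝ n ⟨a, rfl⟩

theorem metric_ιMulti (n : ℕ) (a b : Fin n → M) :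
    metric (ExteriorAlgebra.ιMulti ℝ n a) (ExteriorAlgebra.ιMulti ℝ n b) =
      (Matrix.of fun i j => (inner ℝ (a j) (b i) : ℝ)).det := by
  rw [metric_of_mem (ιMulti_mem n a) (ιMulti_mem n b)]
  exact exteriorPower.inner_ιMulti_ιMulti a b

theorem linearMap_ext_ιMulti {W : Type*} [AddCommGroup W] [Module ℝ W] {f g : RForm M →ₗ[ℝ] W}
    (h : ∀ n (a : Fin n → M), f (ExteriorAlgebra.ιMulti ℝ n a) = g (ExteriorAlgebra.ιMulti ℝ n a)) :
    f = g := by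
  refine LinearMap.ext_on_range (v := fun x : Σ n, (Fin n → M) => ExteriorAlgebra.ιMulti ℝ x.1 x.2)
    (ExteriorAlgebra.ιMulti_span ℝ M) fun x => h x.1 x.2

/-- Wedging with a covector is adjoint to contracting with the dual vector. -/
theorem metric_ι_mul (m : M) (x y : RForm M) :
    metric (ExteriorAlgebra.ι ℝ m * x) y =
      metric x (CliffordAlgebra.contractLeft (innerₗ M m) y) := by
  have key : (metric (M := M)).comp (LinearMap.mulLeft ℝ (ExteriorAlgebra.ι ℝ m)) LinearMap.id =
      (metric (M := M)).compl₂ (CliffordAlgebra.contractLeft (Q := 0) (innerₗ M m)) := by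
    refine linearMap_ext_ιMulti fun n a => linearMap_ext_ιMulti fun k b => ?_
    change metric (ExteriorAlgebra.ι ℝ m * _) _ = metric _ (CliffordAlgebra.contractLeft _ _)
    have h1 : ExteriorAlgebra.ι ℝ m * ExteriorAlgebra.ιMulti ℝ n a =
        ExteriorAlgebra.ιMulti ℝ (n + 1) (Matrix.vecCons m a) := by
      rw [ExteriorAlgebra.ιMulti_succ_apply]; simp
    rw [h1]
    rcases k with _ | k
    · rw [ExteriorAlgebra.ιMulti_zero_apply]
      rw [contractLeft_one, map_zero]
      exact metric_of_mem_ne (Nat.succ_ne_zero n) (ιMulti_mem _ _)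
        (by simp)
    · rw [contractLeft_ιMulti, map_sum]
      by_cases hk : n = k
      · subst hk
        -- The column of `m` in the Gram matrix is expanded; the resulting signed sum is the
        -- expansion of the contraction in `contractLeft_ιMulti`.
        rw [metric_ιMulti, Matrix.det_succ_column_zero]
        refine Finset.sum_congr rfl fun i _ => ?_
        rw [map_smul, metric_ιMulti]
        simp [Matrix.submatrix]
      · rw [metric_of_mem_ne (by omega) (ιMulti_mem _ _) (ιMulti_mem _ _)]
        refine (Finset.sum_eq_zero fun i _ => ?_).symm
        rw [map_smul, metric_of_mem_ne hk (ιMulti_mem _ _) (ιMulti_mem _ _), smul_zero]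
  exact LinearMap.congr_fun (LinearMap.congr_fun key x) y

theorem adj_unique {S T : Module.End ℝ (RForm M)} (h : ∀ x y, metric (S x) y = metric x (T y)) :
    adj T = S := by
  refine LinearMap.ext fun x => sub_eq_zero.1 (metric_nondegenerate.1 _ fun y => ?_)
  rw [map_sub, LinearMap.sub_apply, metric_adj, h, sub_self]

theorem metric_comm (x y : RForm M) : metric x y = metric y x := metric_isSymm.eq x y

theorem metric_one_one : metric (1 : RForm M) 1 = 1 := by
  have h := metric_ιMulti 0 (![] : Fin 0 → M) ![]
  simpa using h

/-- Only scalars are annihilated by all contractions. -/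
theorem eq_algebraMap_of_contractLeft_eq_zero {x : RForm M}
    (h : ∀ m, CliffordAlgebra.contractLeft (Q := (0 : QuadraticForm ℝ M)) (innerₗ M m) x = 0) :
    x = algebraMap ℝ _ (metric 1 x) := by
  rw [← sub_eq_zero]
  refine metric_nondegenerate.2 _ fun y => ?_
  induction y using CliffordAlgebra.left_induction with
  | algebraMap r =>
    have h1 : algebraMap ℝ (CliffordAlgebra (0 : QuadraticForm ℝ M)) r = r • (1 : RForm M) :=
      Algebra.algebraMap_eq_smul_one r
    rw [h1, Algebra.algebraMap_eq_smul_one, map_smul, LinearMap.smul_apply, map_sub, map_smul,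
      metric_one_one]
    simp
  | add y z hy hz => rw [map_add, LinearMap.add_apply, hy, hz, add_zero]
  | ι_mul y m _ =>
    refine (metric_ι_mul m y _).trans ?_
    rw [map_sub, h]
    erw [CliffordAlgebra.contractLeft_algebraMap]
    simp

section Coframe

variable {s : ℕ} (v : OrthonormalBasis (Fin 2 × Fin (s + 1)) ℝ M)

theorem coord_eq_innerₗ (i : Fin 2 × Fin (s + 1)) : v.toBasis.coord i = innerₗ M (v i) := by
  ext x
  simp [OrthonormalBasis.repr_apply_apply]

theorem metric_E (i : Fin 2) (j : Fin (s + 1)) (x y : RForm M) :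
    metric (E v i j x) y = metric x (I v i j y) := by
  rw [I, coord_eq_innerₗ]
  exact metric_ι_mul _ _ _

theorem metric_I (i : Fin 2) (j : Fin (s + 1)) (x y : RForm M) :
    metric (I v i j x) y = metric x (E v i j y) := by
  rw [metric_comm, ← metric_E, metric_comm]

theorem E_mul_E (i k : Fin 2) (j l : Fin (s + 1)) : E v i j * E v k l = -(E v k l * E v i j) := by
  refine LinearMap.ext fun x => ?_
  simp only [E, cov, Module.End.mul_apply, LinearMap.neg_apply, LinearMap.mulLeft_apply,
    ← mul_assoc, ← neg_mul]
  rw [eq_neg_of_add_eq_zero_left (ExteriorAlgebra.ι_add_mul_swap (v (i, j)) (v (k, l)))]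
  simp only [neg_mul]

theorem I_mul_I (i k : Fin 2) (j l : Fin (s + 1)) : I v i j * I v k l = -(I v k l * I v i j) :=
  LinearMap.ext fun x => CliffordAlgebra.contractLeft_comm _ _ x

theorem I_mul_E (i k : Fin 2) (j l : Fin (s + 1)) :
    I v i j * E v k l = (if (k, l) = (i, j) then 1 else 0) - E v k l * I v i j := by
  refine LinearMap.ext fun x => ?_
  have h := CliffordAlgebra.contractLeft_ι_mul (Q := (0 : QuadraticForm ℝ M))
    (v.toBasis.coord (i, j)) (v (k, l)) x
  refine h.trans ?_
  have h' : v.toBasis.coord (i, j) (v (k, l)) = if (k, l) = (i, j) then 1 else 0 := by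
    rw [← v.coe_toBasis, Module.Basis.coord_apply, Module.Basis.repr_self,
      Finsupp.single_apply]
  rw [h', LinearMap.sub_apply]
  congr 1
  split_ifs <;> simp

theorem L_eq (j k : Fin (s + 1)) : L v j k = ∑ i, E v i j * E v i k := by
  refine LinearMap.ext fun x => ?_
  simp [L, E, mul_assoc, add_mul]

theorem V_eq (j : Fin (s + 1)) : V v j = E v 0 j * E v 1 j := by
  refine LinearMap.ext fun x => ?_
  simp [V, E]

/-- Wedging and contraction are mutually adjoint, and taking adjoints reverses the order of the two
factors. That reversal is the source of the negative sign in `rho_lower_imSingle`. -/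
theorem adj_L (j k : Fin (s + 1)) : adj (L v j k) = ∑ i, I v i k * I v i j := by
  refine adj_unique fun x y => ?_
  simp [L_eq, metric_I]

theorem adj_V (j : Fin (s + 1)) : adj (V v j) = I v 1 j * I v 0 j := by
  refine adj_unique fun x y => ?_
  simp [V_eq, metric_I]

end Coframe

end RealForms

end SKaehler

end

noncomputable section

namespace SKaehler

/-! ## The representation of matrices attached to canonical anticommutation relations -/

section CAR

variable {ι A : Type*} [Fintype ι] [DecidableEq ι] [Ring A] [Algebra ℂ A]

/-- Canonical anticommutation relations. -/
structure IsCAR (c d : ι → A) : Prop where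
  cc : ∀ p q, c p * c q = -(c q * c p)
  dd : ∀ p q, d p * d q = -(d q * d p)
  dc : ∀ p q, d p * c q = (if p = q then 1 else 0) - c q * d p

/-- The operator `∑ M_{pq} c_p d_q`. -/
def secondQuantization (c d : ι → A) : Matrix ι ι ℂ →ₗ[ℂ] A where
  toFun M := ∑ p, ∑ q, M p q • (c p * d q)
  map_add' M N := by simp [add_smul, Finset.sum_add_distrib]
  map_smul' z M := by simp [mul_smul, Finset.smul_sum]

theorem secondQuantization_apply (c d : ι → A) (M : Matrix ι ι ℂ) :
    secondQuantization c d M = ∑ p, ∑ q, M p q • (c p * d q) := rfl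

theorem secondQuantization_single (c d : ι → A) (p q : ι) (z : ℂ) :
    secondQuantization c d (Matrix.single p q z) = z • (c p * d q) := by
  rw [secondQuantization_apply, Finset.sum_eq_single p, Finset.sum_eq_single q]
  · simp
  · intro b _ hb; simp [hb.symm]
  · simp
  · intro b _ hb; simp [hb.symm]
  · simp

namespace IsCAR

variable {c d : ι → A} (h : IsCAR c d)

include h

theorem lie_c (M : Matrix ι ι ℂ) (r : ι) :
    secondQuantization c d M * c r - c r * secondQuantization c d M = ∑ p, M p r • c p := by
  have key : ∀ p q, c p * d q * c r - c r * (c p * d q) = if q = r then c p else 0 := by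
    intro p q
    rw [mul_assoc, h.dc, ← mul_assoc, h.cc r p, mul_sub]
    split_ifs <;> noncomm_ring
  simp only [secondQuantization_apply, Finset.sum_mul, Finset.mul_sum, ← Finset.sum_sub_distrib,
    smul_mul_assoc, mul_smul_comm, ← smul_sub, key]
  simp

theorem lie_d (M : Matrix ι ι ℂ) (r : ι) :
    secondQuantization c d M * d r - d r * secondQuantization c d M = -∑ q, M r q • d q := by
  have key : ∀ p q, c p * d q * d r - d r * (c p * d q) = if r = p then -d q else 0 := by
    intro p q
    rw [← mul_assoc (d r), h.dc, mul_assoc, h.dd q r, sub_mul]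
    split_ifs <;> noncomm_ring
  simp only [secondQuantization_apply, Finset.sum_mul, Finset.mul_sum, ← Finset.sum_sub_distrib,
    smul_mul_assoc, mul_smul_comm, ← smul_sub, key]
  rw [Finset.sum_eq_single r]
  · simp
  · intro p _ hp; simp [hp.symm]
  · simp

/-- The commutator with the image of `M` is a derivation; by `lie_c` and `lie_d` it acts on the `c`
by `M` and on the `d` by minus the transpose, and the Leibniz rule on `c_r d_t` gives the two halves
of `M N - N M`. -/
theorem secondQuantization_lie (M N : Matrix ι ι ℂ) :
    secondQuantization c d (M * N - N * M) =
      secondQuantization c d M * secondQuantization c d N -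
        secondQuantization c d N * secondQuantization c d M := by
  set S := secondQuantization c d M with hS
  have key : ∀ r t, S * (c r * d t) - c r * d t * S =
      ∑ p, M p r • (c p * d t) - ∑ q, M t q • (c r * d q) := by
    intro r t
    have h1 : S * (c r * d t) - c r * d t * S =
        (S * c r - c r * S) * d t + c r * (S * d t - d t * S) := by noncomm_ring
    rw [h1, hS, h.lie_c, h.lie_d, Finset.sum_mul, mul_neg, Finset.mul_sum, ← sub_eq_add_neg]
    simp only [smul_mul_assoc, mul_smul_comm]
  rw [secondQuantization_apply (M := N)]
  simp only [Finset.sum_mul, Finset.mul_sum, ← Finset.sum_sub_distrib,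
    smul_mul_assoc, mul_smul_comm, ← smul_sub, key]
  simp only [smul_sub, Finset.sum_sub_distrib, map_sub, Finset.smul_sum]
  congr 1
  · simp only [secondQuantization_apply, Matrix.mul_apply, Finset.sum_smul, mul_smul]
    rw [Finset.sum_comm]
    conv_rhs => rw [Finset.sum_comm]
    refine Finset.sum_congr rfl fun t _ => ?_
    rw [Finset.sum_comm]
    refine Finset.sum_congr rfl fun r _ => Finset.sum_congr rfl fun p _ => ?_
    rw [smul_comm]
  · simp only [secondQuantization_apply, Matrix.mul_apply, Finset.sum_smul, mul_smul]
    refine Finset.sum_congr rfl fun t _ => ?_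
    rw [Finset.sum_comm]

/-- Recovers each matrix entry from the operator. This yields faithfulness here, and later the
vanishing of operators with values in the radical. -/
theorem anticommutator_lie (M : Matrix ι ι ℂ) (p r : ι) :
    d p * (secondQuantization c d M * c r - c r * secondQuantization c d M) +
      (secondQuantization c d M * c r - c r * secondQuantization c d M) * d p =
      M p r • (1 : A) := by
  rw [h.lie_c, Finset.mul_sum, Finset.sum_mul, ← Finset.sum_add_distrib]
  simp only [mul_smul_comm, smul_mul_assoc, ← smul_add, h.dc, sub_add_cancel]
  simp

theorem secondQuantization_injective [Nontrivial A] :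
    Function.Injective (secondQuantization c d) := by
  rw [injective_iff_map_eq_zero]
  intro M hM
  ext p r
  have h1 := h.anticommutator_lie M p r
  rw [hM] at h1
  simp only [zero_mul, mul_zero, sub_zero, add_zero] at h1
  simpa using h1.symm

end IsCAR

end CAR

/-! ## Generation of `𝔰𝔲(n, n)` -/

section Generation

open Matrix

variable {n : Type*} [Fintype n] [DecidableEq n]

/-- Strictly upper block triangular matrices. -/
def upper (B : Matrix n n ℂ) : Matrix (n ⊕ n) (n ⊕ n) ℂ := fromBlocks 0 B 0 0

/-- Strictly lower block triangular matrices. -/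
def lower (C : Matrix n n ℂ) : Matrix (n ⊕ n) (n ⊕ n) ℂ := fromBlocks 0 0 C 0

/-- Block diagonal matrices with blocks `P` and `-P^*`. -/
def skewDiag (P : Matrix n n ℂ) : Matrix (n ⊕ n) (n ⊕ n) ℂ := fromBlocks P 0 0 (-Pᴴ)

/-- The lower right block of the commutator is `-C B`, which is `-(B C)^*` exactly because both
blocks are Hermitian. -/
theorem lie_upper_lower {B C : Matrix n n ℂ} (hB : Bᴴ = B) (hC : Cᴴ = C) :
    ⁅upper B, lower C⁆ = skewDiag (B * C) := by
  simp [upper, lower, skewDiag, Ring.lie_def, fromBlocks_multiply, sub_eq_add_neg,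
    fromBlocks_neg, fromBlocks_add, conjTranspose_mul, hB, hC]

theorem lie_skewDiag_upper (P B : Matrix n n ℂ) :
    ⁅skewDiag P, upper B⁆ = upper (P * B + B * Pᴴ) := by
  simp [upper, skewDiag, Ring.lie_def, fromBlocks_multiply, sub_eq_add_neg,
    fromBlocks_neg, fromBlocks_add]

theorem lie_skewDiag_lower (P C : Matrix n n ℂ) :
    ⁅skewDiag P, lower C⁆ = -lower (Pᴴ * C + C * P) := by
  simp [lower, skewDiag, Ring.lie_def, fromBlocks_multiply, sub_eq_add_neg,
    fromBlocks_neg, fromBlocks_add, add_comm]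

theorem lie_skewDiag_skewDiag (P Q : Matrix n n ℂ) :
    ⁅skewDiag P, skewDiag Q⁆ = skewDiag (P * Q - Q * P) := by
  simp [skewDiag, Ring.lie_def, fromBlocks_multiply, sub_eq_add_neg,
    fromBlocks_neg, fromBlocks_add, add_comm, conjTranspose_mul]

variable (n) in
/-- `upper`, as an `ℝ`-linear map. -/
def upperₗ : Matrix n n ℂ →ₗ[ℝ] Matrix (n ⊕ n) (n ⊕ n) ℂ where
  toFun := upper
  map_add' := by simp [upper, fromBlocks_add]
  map_smul' := by simp [upper, fromBlocks_smul]

variable (n) in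
/-- `lower`, as an `ℝ`-linear map. -/
def lowerₗ : Matrix n n ℂ →ₗ[ℝ] Matrix (n ⊕ n) (n ⊕ n) ℂ where
  toFun := lower
  map_add' := by simp [lower, fromBlocks_add]
  map_smul' := by simp [lower, fromBlocks_smul]

variable (n) in
/-- `skewDiag`, as an `ℝ`-linear map. -/
def skewDiagₗ : Matrix n n ℂ →ₗ[ℝ] Matrix (n ⊕ n) (n ⊕ n) ℂ where
  toFun := skewDiag
  map_add' := by simp [skewDiag, fromBlocks_add, add_comm]
  map_smul' := by simp [skewDiag, fromBlocks_smul]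

/-- The Hermitian matrix `i (E_{jk} - E_{kj})`. -/
def imSingle (j k : n) : Matrix n n ℂ := Complex.I • (single j k 1 - single k j 1)

theorem imSingle_conjTranspose (j k : n) : (imSingle j k)ᴴ = imSingle j k := by
  simp [imSingle, conjTranspose_smul, conjTranspose_sub, ← smul_neg]

theorem single_conjTranspose (j : n) : (single j j (1 : ℂ))ᴴ = single j j 1 := by simp

theorem hermitian_mem (S : Submodule ℝ (Matrix n n ℂ))
    (h1 : ∀ j k, single j k 1 + single k j 1 ∈ S) (h2 : ∀ j k, imSingle j k ∈ S)
    {B : Matrix n n ℂ} (hB : Bᴴ = B) : B ∈ S := by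
  have key : B = (1 / 2 : ℝ) • ∑ j, ∑ k, ((B j k).re • (single j k 1 + single k j 1) +
      (B j k).im • imSingle j k) := by
    have e1 : ∑ j, ∑ k, ((B j k).re • (single j k 1 + single k j 1) +
        (B j k).im • imSingle j k) = B + Bᴴ := by
      have hh : ∀ j k, (B j k).re • (single j k (1 : ℂ) + single k j 1) +
        (B j k).im • imSingle j k = single j k (B j k) + single k j (star (B j k)) := by
        intro j k
        ext a b
        simp only [imSingle, Matrix.add_apply, Matrix.smul_apply, Matrix.sub_apply, single_apply]
        split_ifs <;> simp [Complex.ext_iff]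
      simp only [hh, Finset.sum_add_distrib]
      congr 1
      · exact (matrix_eq_sum_single B).symm
      · rw [Finset.sum_comm]
        conv_rhs => rw [matrix_eq_sum_single Bᴴ]
        rfl
    rw [e1, hB, ← two_smul ℝ, smul_smul]
    norm_num
  rw [key]
  exact S.smul_mem _ (S.sum_mem fun j _ => S.sum_mem fun k _ =>
    S.add_mem (S.smul_mem _ (h1 j k)) (S.smul_mem _ (h2 j k)))

/-- Write `P` entrywise, replacing each `i E_{jj}` by `i (E_{jj} - E_{oo})` for a fixed index `o`.
The total correction is `Im (tr P)` times `i E_{oo}`, hence zero. -/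
theorem mem_of_trace_im_eq_zero (S : Submodule ℝ (Matrix n n ℂ))
    (h1 : ∀ j k, single j k 1 ∈ S) (h2 : ∀ j k, j ≠ k → Complex.I • single j k 1 ∈ S)
    (h3 : ∀ j k, j ≠ k → Complex.I • (single j j 1 - single k k 1) ∈ S)
    {P : Matrix n n ℂ} (hP : P.trace.im = 0) : P ∈ S := by
  rcases isEmpty_or_nonempty n with hn | ⟨⟨o⟩⟩
  · rw [Subsingleton.elim P 0]; exact S.zero_mem
  have key : P = ∑ j, ∑ k, ((P j k).re • single j k 1 +
      (P j k).im • (Complex.I • (single j k 1 - if j = k then single o o 1 else 0))) := by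
    have e : ∀ j k, (P j k).re • single j k (1 : ℂ) +
        (P j k).im • (Complex.I • (single j k 1 - if j = k then single o o 1 else 0)) =
        single j k (P j k) -
          if j = k then (P j k).im • (Complex.I • single o o (1 : ℂ)) else 0 := by
      intro j k
      have e1 : single j k (P j k) = (P j k).re • single j k (1 : ℂ) +
          (P j k).im • (Complex.I • single j k 1) := by
        ext a b
        simp only [Matrix.add_apply, Matrix.smul_apply, single_apply]
        split_ifs <;> simp
      rw [e1]
      split_ifs
      · rw [smul_sub, smul_sub]; abel
      · simp
    simp only [e, Finset.sum_sub_distrib]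
    rw [← matrix_eq_sum_single P, eq_comm, sub_eq_self]
    simp only [Finset.sum_ite_eq, Finset.mem_univ, if_true, ← Finset.sum_smul]
    have e2 : ∑ j, (P j j).im = P.trace.im := by simp [trace]
    rw [e2, hP, zero_smul]
  rw [key]
  refine S.sum_mem fun j _ => S.sum_mem fun k _ =>
    S.add_mem (S.smul_mem _ (h1 j k)) (S.smul_mem _ ?_)
  by_cases hjk : j = k
  · subst hjk
    by_cases hj : j = o
    · subst hj; simp
    · simpa using h3 j o hj
  · simpa [hjk] using h2 j k hjk

variable (U : LieSubalgebra ℝ (Matrix (n ⊕ n) (n ⊕ n) ℂ))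

/-- A Lie algebra that contains the matrices of the generators contains every matrix that is
infinitesimally unitary for the split form and has trace zero. -/
theorem fromBlocks_mem_of_generators (h3 : ∀ j k : n, ∃ l, l ≠ j ∧ l ≠ k)
    (hu : ∀ j k, j ≠ k → upper (imSingle j k) ∈ U) (hu' : ∀ j, upper (single j j 1) ∈ U)
    (hl : ∀ j k, j ≠ k → lower (imSingle j k) ∈ U) (hl' : ∀ j, lower (single j j 1) ∈ U)
    {P B C : Matrix n n ℂ} (hP : P.trace.im = 0) (hB : Bᴴ = B) (hC : Cᴴ = C) :
    fromBlocks P B C (-Pᴴ) ∈ U := by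
  have d1 : ∀ j, skewDiag (single j j 1) ∈ U := by
    intro j
    have h := U.lie_mem (hu' j) (hl' j)
    rw [lie_upper_lower (single_conjTranspose j) (single_conjTranspose j)] at h
    simpa using h
  -- `E_{jj} * i (E_{jk} - E_{kj}) = i E_{jk}`.
  have d2 : ∀ j k, j ≠ k → skewDiag (Complex.I • single j k 1) ∈ U := by
    intro j k hjk
    have h := U.lie_mem (hu' j) (hl j k hjk)
    rw [lie_upper_lower (single_conjTranspose j) (imSingle_conjTranspose j k)] at h
    simpa [imSingle, mul_sub, hjk] using h
  have d3 : ∀ j k, skewDiag (single j k 1) ∈ U := by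
    intro j k
    by_cases hjk : j = k
    · subst hjk; exact d1 j
    -- A third index is needed: only with `l` different from both does the product of `i (E_{jl} -
    -- E_{lj})` and `i (E_{lk} - E_{kl})` reduce to the single term `-E_{jk}`.
    obtain ⟨l, hlj, hlk⟩ := h3 j k
    have h := U.lie_mem (hu j l hlj.symm) (hl l k hlk)
    rw [lie_upper_lower (imSingle_conjTranspose _ _) (imSingle_conjTranspose _ _)] at h
    have e : imSingle j l * imSingle l k = -single j k (1 : ℂ) := by
      simp [imSingle, mul_sub, sub_mul, hjk, hlj.symm, hlk, single_neg]
    rw [e] at h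
    have h' := U.neg_mem h
    have e2 : -skewDiag (-single j k (1 : ℂ)) = skewDiag (single j k 1) := by
      simp [skewDiag, fromBlocks_neg]
    rwa [e2] at h'
  have d4 : ∀ j k, j ≠ k → skewDiag (Complex.I • (single j j 1 - single k k 1)) ∈ U := by
    intro j k hjk
    have h := U.lie_mem (d3 j k) (d2 k j hjk.symm)
    rw [lie_skewDiag_skewDiag] at h
    simpa [smul_sub] using h
  -- The diagonal blocks act on Hermitian blocks by `B ↦ P B + B P^*`; with `P = E_{jk}` and `B =
  -- E_{kk}` this gives the real symmetric matrices.
  have u1 : ∀ j k, upper (single j k 1 + single k j 1) ∈ U := by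
    intro j k
    have h := U.lie_mem (d3 j k) (hu' k)
    rw [lie_skewDiag_upper] at h
    simpa using h
  have l1 : ∀ j k, lower (single j k 1 + single k j 1) ∈ U := by
    intro j k
    have h := U.neg_mem (U.lie_mem (d3 k j) (hl' k))
    rw [lie_skewDiag_lower, neg_neg] at h
    simpa using h
  have im0 : ∀ j : n, imSingle j j = 0 := by intro j; simp [imSingle]
  have mP : P ∈ U.toSubmodule.comap (skewDiagₗ n) :=
    mem_of_trace_im_eq_zero _ d3 d2 d4 hP
  have mB : B ∈ U.toSubmodule.comap (upperₗ n) := by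
    refine hermitian_mem _ u1 (fun j k => ?_) hB
    by_cases hjk : j = k
    · subst hjk; rw [im0]; exact Submodule.zero_mem _
    · exact hu j k hjk
  have mC : C ∈ U.toSubmodule.comap (lowerₗ n) := by
    refine hermitian_mem _ l1 (fun j k => ?_) hC
    by_cases hjk : j = k
    · subst hjk; rw [im0]; exact Submodule.zero_mem _
    · exact hl j k hjk
  have e : fromBlocks P B C (-Pᴴ) = skewDiag P + upper B + lower C := by
    simp [skewDiag, upper, lower, fromBlocks_add]
  rw [e]
  exact U.add_mem (U.add_mem mP mB) mC

variable (n) in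
/-- The Cayley matrix, which carries the split Hermitian form to the diagonal one. -/
def cayley : Matrix (n ⊕ n) (n ⊕ n) ℂ := fromBlocks 1 (Complex.I • 1) 1 (-Complex.I • 1)

variable (n) in
/-- The inverse of the Cayley matrix. -/
def cayleyInv : Matrix (n ⊕ n) (n ⊕ n) ℂ :=
  (1 / 2 : ℂ) • fromBlocks 1 1 (-Complex.I • 1) (Complex.I • 1)

theorem cayley_mul_cayleyInv : cayley n * cayleyInv n = 1 := by
  rw [cayley, cayleyInv, mul_smul_comm, fromBlocks_multiply, ← fromBlocks_one, fromBlocks_smul]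
  simp [smul_smul, ← two_smul ℂ (1 : Matrix n n ℂ)]

theorem cayleyInv_mul_cayley : cayleyInv n * cayley n = 1 :=
  mul_eq_one_comm.1 cayley_mul_cayleyInv

theorem cayley_form : (cayley n)ᴴ * LieAlgebra.Orthogonal.indefiniteDiagonal n n ℂ * cayley n =
    (2 * Complex.I) • fromBlocks 0 1 (-1) 0 := by
  have h : LieAlgebra.Orthogonal.indefiniteDiagonal n n ℂ = fromBlocks 1 0 0 (-1) :=
    LieAlgebra.Orthogonal.s_as_blocks n ℂ
  rw [h, cayley, fromBlocks_conjTranspose, fromBlocks_multiply, fromBlocks_multiply,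
    fromBlocks_smul]
  congr 1 <;> simp [smul_smul, two_mul, add_smul, conjTranspose_smul]

/-- Conjugation by the Cayley matrix exchanges the split and the diagonal Hermitian form. -/
theorem cayley_conj_mem_iff (M : Matrix (n ⊕ n) (n ⊕ n) ℂ) :
    (cayley n * M * cayleyInv n)ᴴ * LieAlgebra.Orthogonal.indefiniteDiagonal n n ℂ +
        LieAlgebra.Orthogonal.indefiniteDiagonal n n ℂ * (cayley n * M * cayleyInv n) = 0 ↔
      Mᴴ * fromBlocks 0 1 (-1) 0 + fromBlocks 0 1 (-1) 0 * M = 0 := by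
  set D := LieAlgebra.Orthogonal.indefiniteDiagonal n n ℂ
  set K : Matrix (n ⊕ n) (n ⊕ n) ℂ := fromBlocks 0 1 (-1) 0
  set T := cayley n with hT
  set T' := cayleyInv n with hT'
  set A := T * M * T' with hA
  have h1 : A * T = T * M := by
    rw [hA, mul_assoc, hT, hT', cayleyInv_mul_cayley, mul_one]
  -- Congruence by `T` turns the condition on `A` for `D` into the condition on `M` for `T^* D T =
  -- 2i K`; as `T` is invertible nothing is lost.
  have h2 : Tᴴ * (Aᴴ * D + D * A) * T = (2 * Complex.I) • (Mᴴ * K + K * M) := by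
    calc Tᴴ * (Aᴴ * D + D * A) * T = (A * T)ᴴ * D * T + Tᴴ * D * (A * T) := by
          rw [conjTranspose_mul A T]; noncomm_ring
      _ = Mᴴ * (Tᴴ * D * T) + (Tᴴ * D * T) * M := by
          rw [h1, conjTranspose_mul T M]; noncomm_ring
      _ = _ := by rw [hT, cayley_form, mul_smul_comm, smul_mul_assoc, smul_add]
  constructor
  · intro h
    rw [h, mul_zero, zero_mul] at h2
    exact (smul_eq_zero.1 h2.symm).resolve_left (by simp)
  · intro h
    rw [h, smul_zero] at h2
    have h3 : T'ᴴ * (Tᴴ * (Aᴴ * D + D * A) * T) * T' =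
        (T * T')ᴴ * (Aᴴ * D + D * A) * (T * T') := by
      rw [conjTranspose_mul T T']; noncomm_ring
    rw [h2, hT, hT', cayley_mul_cayleyInv] at h3
    simpa using h3.symm

/-- Identifies the block shape produced by the generators with the infinitesimal isometries of the
split form. The form matrix used is skew-Hermitian; multiplying it by `i` makes it Hermitian without
changing the condition. -/
theorem split_form_iff (P B C D : Matrix n n ℂ) :
    (fromBlocks P B C D)ᴴ * fromBlocks 0 1 (-1) 0 +
        fromBlocks 0 1 (-1) 0 * fromBlocks P B C D = 0 ↔ Bᴴ = B ∧ Cᴴ = C ∧ D = -Pᴴ := by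
  rw [fromBlocks_conjTranspose, fromBlocks_multiply, fromBlocks_multiply, fromBlocks_add,
    ← fromBlocks_zero, fromBlocks_inj]
  simp only [mul_zero, zero_add, mul_neg, mul_one, neg_mul, one_mul, zero_mul, add_zero]
  constructor
  · rintro ⟨h1, h2, h3, h4⟩
    refine ⟨(add_neg_eq_zero.1 h4), (neg_add_eq_zero.1 h1), ?_⟩
    exact eq_neg_of_add_eq_zero_right h2
  · rintro ⟨h1, h2, h3⟩
    simp [h1, h2, h3]

end Generation

end SKaehler

end

noncomputable section

namespace SKaehler

/-! ### Fermionic operators from `z_j` and `conj z_j`, and the matrices of the generators -/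

section Operators

theorem eq_zero_of_eq_neg {W : Type*} [AddCommGroup W] [Module ℂ W] {x : W} (h : x = -x) :
    x = 0 := by
  have h2 : (2 : ℂ) • x = 0 := by
    rw [two_smul]
    nth_rewrite 1 [h]
    exact neg_add_cancel x
  simpa using h2

variable {M : Type*} [NormedAddCommGroup M] [InnerProductSpace ℝ M] [FiniteDimensional ℝ M]
variable {s : ℕ} (v : OrthonormalBasis (Fin 2 × Fin (s + 1)) ℝ M)

/-- Exterior multiplication by `v_{1j} + z v_{2j}`. -/
def wedgeC (z : ℂ) (j : Fin (s + 1)) : Module.End ℂ (CForm M) :=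
  (E v 0 j).baseChange ℂ + z • (E v 1 j).baseChange ℂ

/-- Contraction with the vector dual to `v_{1j}` plus `z` times the one dual to `v_{2j}`. -/
def contractC (z : ℂ) (j : Fin (s + 1)) : Module.End ℂ (CForm M) :=
  (I v 0 j).baseChange ℂ + z • (I v 1 j).baseChange ℂ

theorem E_baseChange_anticomm (i k : Fin 2) (j l : Fin (s + 1)) :
    (E v i j).baseChange ℂ * (E v k l).baseChange ℂ =
      -((E v k l).baseChange ℂ * (E v i j).baseChange ℂ) := by
  rw [← LinearMap.baseChange_mul, E_mul_E, LinearMap.baseChange_neg, LinearMap.baseChange_mul]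

theorem I_baseChange_anticomm (i k : Fin 2) (j l : Fin (s + 1)) :
    (I v i j).baseChange ℂ * (I v k l).baseChange ℂ =
      -((I v k l).baseChange ℂ * (I v i j).baseChange ℂ) := by
  rw [← LinearMap.baseChange_mul, I_mul_I, LinearMap.baseChange_neg, LinearMap.baseChange_mul]

theorem I_mul_E_baseChange (i k : Fin 2) (j l : Fin (s + 1)) :
    (I v i j).baseChange ℂ * (E v k l).baseChange ℂ =
      (if (k, l) = (i, j) then 1 else 0) - (E v k l).baseChange ℂ * (I v i j).baseChange ℂ := by
  rw [← LinearMap.baseChange_mul, I_mul_E, LinearMap.baseChange_sub, LinearMap.baseChange_mul]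
  congr 1
  split_ifs
  · exact LinearMap.baseChange_one ℝ _
  · exact LinearMap.baseChange_zero

theorem wedgeC_anticomm (z w : ℂ) (j k : Fin (s + 1)) :
    wedgeC v z j * wedgeC v w k = -(wedgeC v w k * wedgeC v z j) := by
  simp only [wedgeC, add_mul, mul_add, smul_mul_assoc, mul_smul_comm,
    E_baseChange_anticomm v _ _ j k]
  module

theorem contractC_anticomm (z w : ℂ) (j k : Fin (s + 1)) :
    contractC v z j * contractC v w k = -(contractC v w k * contractC v z j) := by
  simp only [contractC, add_mul, mul_add, smul_mul_assoc, mul_smul_comm,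
    I_baseChange_anticomm v _ _ j k]
  module

/-- The scalar `1 + z w` is `0` for `z = w = ±i` and `2` for `z = -w = ±i`. So contraction and
wedging with equal parameters anticommute, and the factor `1/2` in `creation` and `annihilation`
normalizes the other case. -/
theorem contractC_mul_wedgeC (z w : ℂ) (j k : Fin (s + 1)) :
    contractC v z j * wedgeC v w k =
      (if j = k then (1 + z * w) • (1 : Module.End ℂ (CForm M)) else 0) -
        wedgeC v w k * contractC v z j := by
  simp only [contractC, wedgeC, add_mul, mul_add, smul_mul_assoc, mul_smul_comm,
    I_mul_E_baseChange, Prod.mk.injEq, eq_comm (a := k) (b := j)]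
  by_cases h : j = k <;> simp only [h] <;> simp <;> module

/-- The creation operators of the oscillator representation of `𝔤𝔩(2 (s + 1))`. -/
def creation : Fin (s + 1) ⊕ Fin (s + 1) → Module.End ℂ (CForm M) :=
  Sum.elim (wedgeC v Complex.I) (fun j => (1 / 2 : ℂ) • contractC v Complex.I j)

/-- The annihilation operators of the oscillator representation of `𝔤𝔩(2 (s + 1))`. -/
def annihilation : Fin (s + 1) ⊕ Fin (s + 1) → Module.End ℂ (CForm M) :=
  Sum.elim (fun j => (1 / 2 : ℂ) • contractC v (-Complex.I) j) (wedgeC v (-Complex.I))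

/-- For the `conj z_j` the roles are exchanged: wedging annihilates and contraction creates. This
exchange makes `L` and `V`, which wedge with two covectors, expressible through products `c_p d_q`.
-/
theorem isCAR : IsCAR (creation v) (annihilation v) where
  cc := by
    rintro (j | j) (k | k)
    · exact wedgeC_anticomm v _ _ _ _
    · simp [creation, contractC_mul_wedgeC]
    · simp [creation, contractC_mul_wedgeC]
    · simp only [creation, Sum.elim_inr, smul_mul_smul_comm, contractC_anticomm v _ _ j k,
        smul_neg]
  dd := by
    rintro (j | j) (k | k)
    · simp only [annihilation, Sum.elim_inl, smul_mul_smul_comm, contractC_anticomm v _ _ j k,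
        smul_neg]
    · simp [annihilation, contractC_mul_wedgeC]
    · simp [annihilation, contractC_mul_wedgeC]
    · exact wedgeC_anticomm v _ _ _ _
  dc := by
    rintro (j | j) (k | k)
    · simp only [annihilation, creation, Sum.elim_inl, smul_mul_assoc, mul_smul_comm,
        contractC_mul_wedgeC, Sum.inl.injEq, smul_sub]
      congr 1
      split_ifs
      · simp; module
      · simp
    · simp only [annihilation, creation, Sum.elim_inl, Sum.elim_inr, smul_mul_smul_comm,
        contractC_anticomm v _ _ j k]
      simp
    · simp only [annihilation, creation, Sum.elim_inl, Sum.elim_inr,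
        wedgeC_anticomm v _ _ j k]
      simp
    · simp only [annihilation, creation, Sum.elim_inr, smul_mul_assoc, mul_smul_comm,
        contractC_mul_wedgeC, Sum.inr.injEq, smul_sub, eq_comm (a := k) (b := j)]
      split_ifs
      · simp; module
      · simp

/-- The representation of matrices by quadratic operators. -/
abbrev rho : Matrix (Fin (s + 1) ⊕ Fin (s + 1)) (Fin (s + 1) ⊕ Fin (s + 1)) ℂ →ₗ[ℂ]
    Module.End ℂ (CForm M) :=
  secondQuantization (creation v) (annihilation v)

theorem upper_single {n : Type*} [DecidableEq n] (j k : n) (z : ℂ) :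
    upper (Matrix.single j k z) = Matrix.single (Sum.inl j) (Sum.inr k) z := by
  ext (a | a) (b | b) <;> simp [upper, Matrix.single_apply]

theorem lower_single {n : Type*} [DecidableEq n] (j k : n) (z : ℂ) :
    lower (Matrix.single j k z) = Matrix.single (Sum.inr j) (Sum.inl k) z := by
  ext (a | a) (b | b) <;> simp [lower, Matrix.single_apply]

theorem upper_imSingle {n : Type*} [DecidableEq n] (j k : n) :
    upper (imSingle j k) = Complex.I • (Matrix.single (Sum.inl j) (Sum.inr k) 1 -
      Matrix.single (Sum.inl k) (Sum.inr j) 1) := by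
  rw [← upper_single, ← upper_single]
  simp [upper, imSingle, Matrix.fromBlocks_smul, sub_eq_add_neg, Matrix.fromBlocks_neg,
    Matrix.fromBlocks_add]

theorem lower_imSingle {n : Type*} [DecidableEq n] (j k : n) :
    lower (imSingle j k) = Complex.I • (Matrix.single (Sum.inr j) (Sum.inl k) 1 -
      Matrix.single (Sum.inr k) (Sum.inl j) 1) := by
  rw [← lower_single, ← lower_single]
  simp [lower, imSingle, Matrix.fromBlocks_smul, sub_eq_add_neg, Matrix.fromBlocks_neg,
    Matrix.fromBlocks_add]

/-- The mixed terms in `z_j ∧ conj z_k - z_k ∧ conj z_j` cancel, leaving `2 ω_{jk}`. -/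
theorem rho_upper_imSingle (j k : Fin (s + 1)) :
    rho v (upper (imSingle j k)) = (2 : ℝ) • (Complex.I • (L v j k).baseChange ℂ) := by
  rw [upper_imSingle, map_smul, map_sub, secondQuantization_single, secondQuantization_single,
    L_eq, Fin.sum_univ_two, LinearMap.baseChange_add, LinearMap.baseChange_mul,
    LinearMap.baseChange_mul, smul_comm (2 : ℝ)]
  congr 1
  simp only [creation, annihilation, Sum.elim_inl, Sum.elim_inr, wedgeC, add_mul, mul_add,
    smul_mul_assoc, mul_smul_comm, one_smul, E_baseChange_anticomm v _ _ k j]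
  simp
  match_scalars <;> ring_nf
  all_goals simp [Complex.I_sq]

/-- `z_j ∧ conj z_j = -2i v_{1j} ∧ v_{2j}`: the `i` appears by itself, so the real matrix `E_{jj}`
corresponds to `iV_j`. -/
theorem rho_upper_single (j : Fin (s + 1)) :
    rho v (upper (Matrix.single j j 1)) = (-2 : ℝ) • (Complex.I • (V v j).baseChange ℂ) := by
  have h0 : ∀ i, (E v i j).baseChange ℂ * (E v i j).baseChange ℂ = 0 := fun i =>
    eq_zero_of_eq_neg (E_baseChange_anticomm v i i j j)
  rw [upper_single, secondQuantization_single, V_eq, LinearMap.baseChange_mul]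
  simp only [creation, annihilation, Sum.elim_inl, Sum.elim_inr, wedgeC, add_mul, mul_add,
    smul_mul_assoc, mul_smul_comm, one_smul, E_baseChange_anticomm v 1 0 j j, h0]
  simp
  match_scalars; ring_nf

theorem rho_lower_imSingle (j k : Fin (s + 1)) :
    rho v (lower (imSingle j k)) =
      (-1 / 2 : ℝ) • (Complex.I • (adj (L v j k)).baseChange ℂ) := by
  rw [lower_imSingle, map_smul, map_sub, secondQuantization_single, secondQuantization_single,
    adj_L, Fin.sum_univ_two, LinearMap.baseChange_add, LinearMap.baseChange_mul,
    LinearMap.baseChange_mul, smul_comm (-1 / 2 : ℝ)]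
  congr 1
  simp only [creation, annihilation, Sum.elim_inl, Sum.elim_inr, contractC, add_mul, mul_add,
    smul_mul_assoc, mul_smul_comm, I_baseChange_anticomm v _ _ k j, smul_smul]
  simp
  match_scalars <;> ring_nf
  all_goals norm_num [Complex.I_sq]

theorem rho_lower_single (j : Fin (s + 1)) :
    rho v (lower (Matrix.single j j 1)) =
      (1 / 2 : ℝ) • (Complex.I • (adj (V v j)).baseChange ℂ) := by
  have h0 : ∀ i, (I v i j).baseChange ℂ * (I v i j).baseChange ℂ = 0 := fun i =>
    eq_zero_of_eq_neg (I_baseChange_anticomm v i i j j)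
  rw [lower_single, secondQuantization_single, adj_V, LinearMap.baseChange_mul]
  simp only [creation, annihilation, Sum.elim_inl, Sum.elim_inr, contractC, add_mul, mul_add,
    smul_mul_assoc, mul_smul_comm, I_baseChange_anticomm v 0 1 j j, smul_smul, h0]
  simp
  match_scalars; ring_nf

end Operators

end SKaehler

end

noncomputable section

namespace SKaehler

/-! ### The isomorphism with `𝔰𝔲(s + 1, s + 1)` and the complex span -/

section RealLieAlgebra

variable {M : Type*} [NormedAddCommGroup M] [InnerProductSpace ℝ M] [FiniteDimensional ℝ M]
variable {s : ℕ} (v : OrthonormalBasis (Fin 2 × Fin (s + 1)) ℝ M)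

/-- `rho` as a homomorphism of real Lie algebras. -/
def rhoLie : Matrix (Fin (s + 1) ⊕ Fin (s + 1)) (Fin (s + 1) ⊕ Fin (s + 1)) ℂ →ₗ⁅ℝ⁆
    Module.End ℂ (CForm M) :=
  { (rho v).restrictScalars ℝ with
    map_lie' := by
      intro A B
      exact (isCAR v).secondQuantization_lie A B }

theorem rhoLie_injective : Function.Injective (rhoLie v) :=
  (isCAR v).secondQuantization_injective

/-- Conjugation by the Cayley matrix as a homomorphism of real Lie algebras. -/
def cayleyConj (n : Type*) [Fintype n] [DecidableEq n] :
    Matrix (n ⊕ n) (n ⊕ n) ℂ →ₗ⁅ℝ⁆ Matrix (n ⊕ n) (n ⊕ n) ℂ where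
  toFun A := cayleyInv n * A * cayley n
  map_add' A B := by rw [mul_add, add_mul]
  map_smul' r A := by simp
  map_lie' := by
    intro A B
    have h : ∀ A B : Matrix (n ⊕ n) (n ⊕ n) ℂ, cayleyInv n * A * cayley n *
        (cayleyInv n * B * cayley n) = cayleyInv n * (A * B) * cayley n := by
      intro A B
      calc _ = cayleyInv n * A * (cayley n * cayleyInv n) * B * cayley n := by
            simp only [mul_assoc]
        _ = _ := by rw [cayley_mul_cayleyInv, mul_one]; simp only [mul_assoc]
    simp only [Ring.lie_def, h, mul_sub, sub_mul]

theorem cayleyConj_apply {n : Type*} [Fintype n] [DecidableEq n]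
    (A : Matrix (n ⊕ n) (n ⊕ n) ℂ) : cayleyConj n A = cayleyInv n * A * cayley n := rfl

theorem cayley_mul_cayleyConj {n : Type*} [Fintype n] [DecidableEq n]
    (A : Matrix (n ⊕ n) (n ⊕ n) ℂ) : cayley n * cayleyConj n A * cayleyInv n = A := by
  calc _ = cayley n * cayleyInv n * A * (cayley n * cayleyInv n) := by
        simp only [cayleyConj_apply, mul_assoc]
    _ = A := by rw [cayley_mul_cayleyInv, one_mul, mul_one]

theorem cayleyConj_conj {n : Type*} [Fintype n] [DecidableEq n]
    (A : Matrix (n ⊕ n) (n ⊕ n) ℂ) : cayleyConj n (cayley n * A * cayleyInv n) = A := by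
  calc _ = cayleyInv n * cayley n * A * (cayleyInv n * cayley n) := by
        simp only [cayleyConj_apply, mul_assoc]
    _ = A := by rw [cayleyInv_mul_cayley, one_mul, mul_one]

theorem trace_fromBlocks {n : Type*} [Fintype n] (P B C D : Matrix n n ℂ) :
    (Matrix.fromBlocks P B C D).trace = P.trace + D.trace := by
  simp [Matrix.trace]

/-- The representation of `𝔰𝔲(s + 1, s + 1)` on complex forms. -/
def suRep : su (s + 1) (s + 1) →ₗ⁅ℝ⁆ Module.End ℂ (CForm M) :=
  (rhoLie v).comp ((cayleyConj (Fin (s + 1))).comp (su (s + 1) (s + 1)).incl)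

theorem suRep_apply (A : su (s + 1) (s + 1)) :
    suRep v A = rho v (cayleyConj _ (A : Matrix _ _ ℂ)) := rfl

theorem suRep_injective : Function.Injective (suRep v) := by
  intro A B h
  have h1 := rhoLie_injective v h
  have h2 := cayley_mul_cayleyConj (A : Matrix (Fin (s + 1) ⊕ Fin (s + 1)) _ ℂ)
  have h3 := cayley_mul_cayleyConj (B : Matrix (Fin (s + 1) ⊕ Fin (s + 1)) _ ℂ)
  refine Subtype.ext ?_
  rw [← h2, ← h3]
  exact congrArg (fun X => cayley (Fin (s + 1)) * X * cayleyInv (Fin (s + 1))) h1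

theorem rho_mem_range_suRep {P B C : Matrix (Fin (s + 1)) (Fin (s + 1)) ℂ}
    (hP : P.trace.im = 0) (hB : B.conjTranspose = B) (hC : C.conjTranspose = C) :
    rho v (Matrix.fromBlocks P B C (-P.conjTranspose)) ∈ (suRep v).range := by
  set X := Matrix.fromBlocks P B C (-P.conjTranspose) with hX
  refine ⟨⟨cayley _ * X * cayleyInv _, ?_, ?_⟩, ?_⟩
  · exact (cayley_conj_mem_iff X).2 ((split_form_iff _ _ _ _).2 ⟨hB, hC, rfl⟩)
  -- The trace of the block matrix is `tr P - conj (tr P) = 2i Im (tr P)`, so tracelessness amounts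
  -- to `tr P` being real.
  · rw [mul_assoc, Matrix.trace_mul_comm, mul_assoc, cayleyInv_mul_cayley, mul_one, hX,
      trace_fromBlocks, Matrix.trace_neg, Matrix.trace_conjTranspose]
    apply Complex.ext <;> simp [hP]
  · exact congrArg (rho v) (cayleyConj_conj X)

theorem trace_fromBlocks_im_eq_zero {n : Type*} [Fintype n] {P B C : Matrix n n ℂ}
    (h : (Matrix.fromBlocks P B C (-P.conjTranspose)).trace = 0) : P.trace.im = 0 := by
  rw [trace_fromBlocks, Matrix.trace_neg, Matrix.trace_conjTranspose] at h
  have h' := congrArg Complex.im h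
  simp at h'
  linarith

theorem range_suRep_le {U : LieSubalgebra ℝ (Module.End ℂ (CForm M))} (hs : 2 ≤ s)
    (hU : (fun T : Module.End ℝ (RForm M) => Complex.I • T.baseChange ℂ) '' generators v ⊆ U) :
    (suRep v).range ≤ U := by
  have hg : ∀ T ∈ generators v, Complex.I • T.baseChange ℂ ∈ U := fun T hT => hU ⟨T, hT, rfl⟩
  rintro _ ⟨⟨A, hA, hA'⟩, rfl⟩
  change rhoLie v (cayleyConj _ A) ∈ U
  have h1 := (cayley_conj_mem_iff (cayleyConj _ A)).1 (by rwa [cayley_mul_cayleyConj])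
  have h2 : (cayleyConj _ A).trace = 0 := by
    rw [cayleyConj_apply, mul_assoc, Matrix.trace_mul_comm, mul_assoc, cayley_mul_cayleyInv,
      mul_one, hA']
  generalize cayleyConj _ A = X at h1 h2
  obtain ⟨P, B, C, D, rfl⟩ : ∃ P B C D, X = Matrix.fromBlocks P B C D :=
    ⟨_, _, _, _, (Matrix.fromBlocks_toBlocks X).symm⟩
  obtain ⟨hB, hC, rfl⟩ := (split_form_iff _ _ _ _).1 h1
  -- The generation argument takes place among matrices, in the preimage of `U`.
  refine fromBlocks_mem_of_generators (U.comap (rhoLie v)) ?_ ?_ ?_ ?_ ?_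
    (trace_fromBlocks_im_eq_zero h2) hB hC
  · intro j k
    -- Here `2 ≤ s` enters: there are at least three indices.
    obtain ⟨l, hl⟩ := Finset.exists_mem_notMem_of_card_lt_card (s := {j, k}) (t := Finset.univ)
      (lt_of_le_of_lt Finset.card_le_two (by simp; omega))
    simp only [Finset.mem_insert, Finset.mem_singleton, not_or] at hl
    exact ⟨l, hl.2⟩
  · intro j k hjk
    change rho v _ ∈ U
    rw [rho_upper_imSingle]
    exact U.smul_mem _ (hg _ (Or.inl ⟨j, k, hjk, Or.inl rfl⟩))
  · intro j
    change rho v _ ∈ U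
    rw [rho_upper_single]
    exact U.smul_mem _ (hg _ (Or.inr ⟨j, Or.inl rfl⟩))
  · intro j k hjk
    change rho v _ ∈ U
    rw [rho_lower_imSingle]
    exact U.smul_mem _ (hg _ (Or.inl ⟨j, k, hjk, Or.inr rfl⟩))
  · intro j
    change rho v _ ∈ U
    rw [rho_lower_single]
    exact U.smul_mem _ (hg _ (Or.inr ⟨j, Or.inr rfl⟩))

theorem rho_upper_mem_range {B : Matrix (Fin (s + 1)) (Fin (s + 1)) ℂ}
    (hB : B.conjTranspose = B) : rho v (upper B) ∈ (suRep v).range := by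
  simpa [upper] using rho_mem_range_suRep v (P := 0) (C := 0) (by simp) hB (by simp)

theorem rho_lower_mem_range {C : Matrix (Fin (s + 1)) (Fin (s + 1)) ℂ}
    (hC : C.conjTranspose = C) : rho v (lower C) ∈ (suRep v).range := by
  simpa [lower] using rho_mem_range_suRep v (P := 0) (B := 0) (by simp) (by simp) hC

theorem mem_of_smul_mem {W : Type*} [LieRing W] [LieAlgebra ℝ W] {U : LieSubalgebra ℝ W}
    {r : ℝ} (hr : r ≠ 0) {x : W} (h : r • x ∈ U) : x ∈ U := by
  have h' := U.smul_mem r⁻¹ h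
  rwa [smul_smul, inv_mul_cancel₀ hr, one_smul] at h'

/-- Each generator is a nonzero real multiple of an element of the range, which gives one inclusion;
the other is the generation statement for block matrices. -/
theorem range_suRep (hs : 2 ≤ s) : (suRep v).range = uL v := by
  refine le_antisymm (range_suRep_le v hs LieSubalgebra.subset_lieSpan) ?_
  refine LieSubalgebra.lieSpan_le.2 ?_
  rintro _ ⟨T, (⟨j, k, _, rfl | rfl⟩ | ⟨j, rfl | rfl⟩), rfl⟩
  · refine mem_of_smul_mem (r := 2) (by norm_num) ?_
    have h := rho_upper_mem_range v (imSingle_conjTranspose j k)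
    rwa [rho_upper_imSingle] at h
  · refine mem_of_smul_mem (r := -1 / 2) (by norm_num) ?_
    have h := rho_lower_mem_range v (imSingle_conjTranspose j k)
    rwa [rho_lower_imSingle] at h
  · refine mem_of_smul_mem (r := -2) (by norm_num) ?_
    have h := rho_upper_mem_range v (single_conjTranspose j)
    rwa [rho_upper_single] at h
  · refine mem_of_smul_mem (r := 1 / 2) (by norm_num) ?_
    have h := rho_lower_mem_range v (single_conjTranspose j)
    rwa [rho_lower_single] at h

/-- `𝐮𝓛^s` is isomorphic to `𝔰𝔲(s + 1, s + 1)`. -/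
theorem nonempty_uL_equiv_su (hs : 2 ≤ s) : Nonempty (uL v ≃ₗ⁅ℝ⁆ su (s + 1) (s + 1)) :=
  ⟨((LieEquiv.ofInjective (suRep v) (suRep_injective v)).trans
    (LieEquiv.ofEq _ _ (by rw [range_suRep v hs]))).symm⟩

theorem exists_rho_of_mem_uL (hs : 2 ≤ s) {x : Module.End ℂ (CForm M)} (hx : x ∈ uL v) :
    ∃ X, x = rho v X := by
  rw [← range_suRep v hs] at hx
  obtain ⟨A, rfl⟩ := hx
  exact ⟨_, suRep_apply v A⟩

theorem uL_le_LC {x : Module.End ℂ (CForm M)} (hx : x ∈ uL v) : x ∈ LC v := by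
  induction hx using LieSubalgebra.lieSpan_induction with
  | mem x h =>
    obtain ⟨T, hT, rfl⟩ := h
    exact (LC v).smul_mem _ (Submodule.subset_span ⟨T, LieSubalgebra.subset_lieSpan hT, rfl⟩)
  | zero => exact (LC v).zero_mem
  | add x y _ _ hx hy => exact (LC v).add_mem hx hy
  | smul r x _ hx =>
    have h : r • x = (r : ℂ) • x := rfl
    rw [h]
    exact (LC v).smul_mem _ hx
  | lie x y _ _ hx hy => exact (LC v).lie_mem hx hy

theorem lie_mem_span_uL {x y : Module.End ℂ (CForm M)}
    (hx : x ∈ Submodule.span ℂ (uL v : Set (Module.End ℂ (CForm M))))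
    (hy : y ∈ Submodule.span ℂ (uL v : Set (Module.End ℂ (CForm M)))) :
    ⁅x, y⁆ ∈ Submodule.span ℂ (uL v : Set (Module.End ℂ (CForm M))) := by
  induction hx, hy using Submodule.span_induction₂ with
  | mem_mem x y hx hy => exact Submodule.subset_span ((uL v).lie_mem hx hy)
  | zero_left y hy => simp
  | zero_right x hx => simp
  | add_left x y z hx hy hz h1 h2 => rw [add_lie]; exact add_mem h1 h2
  | add_right x y z hx hy hz h1 h2 => rw [lie_add]; exact add_mem h1 h2
  | smul_left r x y hx hy h => rw [smul_lie]; exact Submodule.smul_mem _ _ h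
  | smul_right r x y hx hy h => rw [lie_smul]; exact Submodule.smul_mem _ _ h

/-- Over `ℂ` the generators `T` and `iT` span the same line, and the complex span of a real Lie
algebra is closed under brackets. -/
theorem span_uL : Submodule.span ℂ (uL v : Set (Module.End ℂ (CForm M))) =
    (LC v).toSubmodule := by
  refine le_antisymm (Submodule.span_le.2 fun x hx => uL_le_LC v hx) ?_
  refine Submodule.span_le.2 ?_
  rintro _ ⟨T, hT, rfl⟩
  change T.baseChange ℂ ∈ Submodule.span ℂ (uL v : Set (Module.End ℂ (CForm M)))
  change T ∈ LieSubalgebra.lieSpan ℝ _ _ at hT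
  induction hT using LieSubalgebra.lieSpan_induction with
  | mem T hT =>
    have h : T.baseChange ℂ = (-Complex.I) • (Complex.I • T.baseChange ℂ) := by
      rw [smul_smul]; simp
    rw [h]
    exact Submodule.smul_mem _ _
      (Submodule.subset_span (LieSubalgebra.subset_lieSpan ⟨T, hT, rfl⟩))
  | zero => rw [LinearMap.baseChange_zero]; exact Submodule.zero_mem _
  | add S T _ _ hS hT => rw [LinearMap.baseChange_add]; exact Submodule.add_mem _ hS hT
  | smul r T _ hT =>
    have h : (r • T).baseChange ℂ = (r : ℂ) • T.baseChange ℂ := LinearMap.baseChange_smul r T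
    rw [h]
    exact Submodule.smul_mem _ _ hT
  | lie S T _ _ hS hT =>
    rw [Ring.lie_def, LinearMap.baseChange_sub, LinearMap.baseChange_mul,
      LinearMap.baseChange_mul]
    exact lie_mem_span_uL v hS hT

theorem exists_add_of_mem_LC {x : Module.End ℂ (CForm M)} (hx : x ∈ LC v) :
    ∃ a ∈ uL v, ∃ b ∈ uL v, x = a + Complex.I • b := by
  have hx' : x ∈ Submodule.span ℂ (uL v : Set (Module.End ℂ (CForm M))) := by
    rw [span_uL]; exact hx
  clear hx
  induction hx' using Submodule.span_induction with
  | mem x hx => exact ⟨x, hx, 0, (uL v).zero_mem, by simp⟩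
  | zero => exact ⟨0, (uL v).zero_mem, 0, (uL v).zero_mem, by simp⟩
  | add x y _ _ hx hy =>
    obtain ⟨a, ha, b, hb, rfl⟩ := hx
    obtain ⟨a', ha', b', hb', rfl⟩ := hy
    exact ⟨_, (uL v).add_mem ha ha', _, (uL v).add_mem hb hb', by rw [smul_add]; abel⟩
  | smul z x _ hx =>
    obtain ⟨a, ha, b, hb, rfl⟩ := hx
    refine ⟨_, (uL v).sub_mem ((uL v).smul_mem z.re ha) ((uL v).smul_mem z.im hb), _,
      (uL v).add_mem ((uL v).smul_mem z.im ha) ((uL v).smul_mem z.re hb), ?_⟩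
    have hr : ∀ (r : ℝ) (x : Module.End ℂ (CForm M)), r • x = (r : ℂ) • x := fun _ _ => rfl
    simp only [hr]
    conv_lhs => rw [← Complex.re_add_im z]
    match_scalars
    · ring
    · linear_combination (z.im : ℂ) * Complex.I_sq

end RealLieAlgebra

end SKaehler

end

noncomputable section

namespace SKaehler

section HermitianForm

variable {M : Type*} [NormedAddCommGroup M] [InnerProductSpace ℝ M] [FiniteDimensional ℝ M]

/-! ### The grading involution -/

/-- The grading involution of real forms. -/
def involR : RForm M →ₐ[ℝ] RForm M := CliffordAlgebra.involute (Q := 0)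

theorem involR_ι (m : M) : involR (ExteriorAlgebra.ι ℝ m) = -ExteriorAlgebra.ι ℝ m :=
  CliffordAlgebra.involute_ι m

theorem involR_involR (x : RForm M) : involR (involR x) = x :=
  CliffordAlgebra.involute_involute x

theorem involR_ιMulti (n : ℕ) (a : Fin n → M) :
    involR (ExteriorAlgebra.ιMulti ℝ n a) = (-1 : ℝ) ^ n • ExteriorAlgebra.ιMulti ℝ n a := by
  have h := CliffordAlgebra.involute_prod_map_ι (Q := (0 : QuadraticForm ℝ M)) (List.ofFn a)
  rw [List.map_ofFn, List.length_ofFn] at h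
  rw [ExteriorAlgebra.ιMulti_apply]
  exact h

theorem ι_mul_comm (m : M) (x : RForm M) :
    ExteriorAlgebra.ι ℝ m * x = involR x * ExteriorAlgebra.ι ℝ m := by
  induction x using CliffordAlgebra.left_induction with
  | algebraMap r =>
    have h : involR (algebraMap ℝ (CliffordAlgebra (0 : QuadraticForm ℝ M)) r) =
        algebraMap ℝ (RForm M) r := AlgHom.commutes involR r
    rw [h]
    exact (Algebra.commutes r _).symm
  | add x y hx hy => rw [mul_add, map_add, add_mul, hx, hy]
  | ι_mul x n hx =>
    change _ * (ExteriorAlgebra.ι ℝ n * x) = involR (ExteriorAlgebra.ι ℝ n * x) * _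
    rw [map_mul, involR_ι, mul_assoc, ← hx, ← mul_assoc,
      eq_neg_of_add_eq_zero_left (ExteriorAlgebra.ι_add_mul_swap m n)]
    simp only [neg_mul, mul_assoc]

theorem contractLeft_mul (d : Module.Dual ℝ M) (x y : RForm M) :
    CliffordAlgebra.contractLeft (Q := 0) d (x * y) =
      CliffordAlgebra.contractLeft (Q := 0) d x * y +
        involR x * CliffordAlgebra.contractLeft (Q := 0) d y := by
  induction x using CliffordAlgebra.left_induction with
  | algebraMap r =>
    have h : involR (algebraMap ℝ (CliffordAlgebra (0 : QuadraticForm ℝ M)) r) =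
        algebraMap ℝ (RForm M) r := AlgHom.commutes involR r
    rw [h, CliffordAlgebra.contractLeft_algebraMap_mul, CliffordAlgebra.contractLeft_algebraMap,
      zero_mul, zero_add]
  | add x z hx hz => rw [add_mul, map_add, map_add, map_add, hx, hz]; noncomm_ring
  | ι_mul x n hx =>
    change CliffordAlgebra.contractLeft d (ExteriorAlgebra.ι ℝ n * x * y) =
      CliffordAlgebra.contractLeft d (ExteriorAlgebra.ι ℝ n * x) * y +
        involR (ExteriorAlgebra.ι ℝ n * x) * _
    rw [mul_assoc, contractLeft_ι_mul, contractLeft_ι_mul, hx, map_mul, involR_ι]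
    simp only [sub_mul, smul_mul_assoc, mul_add, neg_mul, mul_assoc]
    abel

theorem involR_contractLeft (d : Module.Dual ℝ M) (x : RForm M) :
    involR (CliffordAlgebra.contractLeft (Q := 0) d x) =
      -CliffordAlgebra.contractLeft (Q := 0) d (involR x) := by
  induction x using CliffordAlgebra.left_induction with
  | algebraMap r =>
    have h : involR (algebraMap ℝ (CliffordAlgebra (0 : QuadraticForm ℝ M)) r) =
        algebraMap ℝ (RForm M) r := AlgHom.commutes involR r
    rw [h]
    erw [CliffordAlgebra.contractLeft_algebraMap]
    simp
  | add x z hx hz => rw [map_add, map_add, hx, hz, map_add, map_add, neg_add]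
  | ι_mul x n hx =>
    change involR (CliffordAlgebra.contractLeft d (ExteriorAlgebra.ι ℝ n * x)) =
      -CliffordAlgebra.contractLeft d (involR (ExteriorAlgebra.ι ℝ n * x))
    rw [contractLeft_ι_mul, map_mul, involR_ι, neg_mul, map_neg, contractLeft_ι_mul, map_sub,
      map_mul, involR_ι, hx, map_smul]
    simp

/-- The grading involution of complex forms. -/
def invol : CForm M →ₐ[ℂ] CForm M := Algebra.TensorProduct.map (AlgHom.id ℂ ℂ) involR

theorem invol_tmul (z : ℂ) (x : RForm M) : invol (z ⊗ₜ[ℝ] x) = z ⊗ₜ[ℝ] involR x := rfl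

theorem invol_invol (x : CForm M) : invol (invol x) = x := by
  induction x using TensorProduct.induction_on with
  | zero => simp
  | tmul z x => rw [invol_tmul, invol_tmul, involR_involR]
  | add x y hx hy => rw [map_add, map_add, hx, hy]

/-! ### Conjugation -/

theorem conj_tmul (z : ℂ) (x : RForm M) : conj (z ⊗ₜ[ℝ] x) = (starRingEnd ℂ z) ⊗ₜ[ℝ] x := rfl

theorem conj_mul (x y : CForm M) : conj (x * y) = conj x * conj y := by
  induction x using TensorProduct.induction_on with
  | zero => simp
  | add x y hx hy => rw [add_mul, map_add, hx, hy, map_add, add_mul]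
  | tmul z x =>
    induction y using TensorProduct.induction_on with
    | zero => simp
    | add x y hx hy => rw [mul_add, map_add, hx, hy, map_add, mul_add]
    | tmul w y => simp [conj_tmul]

theorem conj_conj (x : CForm M) : conj (conj x) = x := by
  induction x using TensorProduct.induction_on with
  | zero => simp
  | tmul z x => simp [conj_tmul]
  | add x y hx hy => rw [map_add, map_add, hx, hy]

theorem conj_invol (x : CForm M) : conj (invol x) = invol (conj x) := by
  induction x using TensorProduct.induction_on with
  | zero => simp
  | tmul z x => rfl
  | add x y hx hy => simp only [map_add, hx, hy]

theorem conj_baseChange (T : Module.End ℝ (RForm M)) (x : CForm M) :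
    conj (T.baseChange ℂ x) = T.baseChange ℂ (conj x) := by
  induction x using TensorProduct.induction_on with
  | zero => simp
  | tmul z x => rfl
  | add x y hx hy => simp only [map_add, hx, hy]

/-! ### Integration of top degree forms -/

section Coframe

variable {s : ℕ} (v : OrthonormalBasis (Fin 2 × Fin (s + 1)) ℝ M)

theorem E_baseChange_apply (i : Fin 2) (j : Fin (s + 1)) (x : CForm M) :
    (E v i j).baseChange ℂ x = (1 ⊗ₜ[ℝ] cov v i j) * x := by
  induction x using TensorProduct.induction_on with
  | zero => simp
  | tmul z x => simp [E]
  | add x y hx hy => simp only [map_add, hx, hy, mul_add]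

theorem cov_mul_comm (i : Fin 2) (j : Fin (s + 1)) (x : CForm M) :
    (1 ⊗ₜ[ℝ] cov v i j) * x = invol x * (1 ⊗ₜ[ℝ] cov v i j) := by
  induction x using TensorProduct.induction_on with
  | zero => simp
  | tmul z x =>
    rw [invol_tmul, Algebra.TensorProduct.tmul_mul_tmul, Algebra.TensorProduct.tmul_mul_tmul,
      one_mul, mul_one, cov, ι_mul_comm]
  | add x y hx hy => simp only [map_add, hx, hy, mul_add, add_mul]

theorem I_baseChange_mul (i : Fin 2) (j : Fin (s + 1)) (x y : CForm M) :
    (I v i j).baseChange ℂ (x * y) =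
      (I v i j).baseChange ℂ x * y + invol x * (I v i j).baseChange ℂ y := by
  induction x using TensorProduct.induction_on with
  | zero => simp
  | add x z hx hz => simp only [map_add, add_mul, hx, hz]; abel
  | tmul z x =>
    induction y using TensorProduct.induction_on with
    | zero => simp
    | add y z hy hz => simp only [map_add, mul_add, hy, hz]; abel
    | tmul w y =>
      simp only [invol_tmul, Algebra.TensorProduct.tmul_mul_tmul, LinearMap.baseChange_tmul, I,
        contractLeft_mul, TensorProduct.tmul_add]

theorem invol_I_baseChange (i : Fin 2) (j : Fin (s + 1)) (x : CForm M) :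
    invol ((I v i j).baseChange ℂ x) = -(I v i j).baseChange ℂ (invol x) := by
  induction x using TensorProduct.induction_on with
  | zero => simp
  | tmul z x =>
    simp only [invol_tmul, LinearMap.baseChange_tmul, I, involR_contractLeft,
      TensorProduct.tmul_neg]
  | add x y hx hy => simp only [map_add, hx, hy, neg_add]

theorem invol_E_baseChange (i : Fin 2) (j : Fin (s + 1)) (x : CForm M) :
    invol ((E v i j).baseChange ℂ x) = -(E v i j).baseChange ℂ (invol x) := by
  rw [E_baseChange_apply, E_baseChange_apply, map_mul, invol_tmul, cov, involR_ι,
    ← neg_one_smul ℝ (ExteriorAlgebra.ι ℝ _), TensorProduct.tmul_smul, smul_mul_assoc]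
  exact neg_one_smul ℝ _

/-- The real volume form. -/
def volR : RForm M := (List.ofFn fun j : Fin (s + 1) => cov v 0 j * cov v 1 j).prod

theorem list_prod_eq_zero {R : Type*} [Ring R] {a b : R} {l : List R}
    (hc : ∀ x ∈ l, a * x = x * a) (hb : b ∈ l) (hab : a * b = 0) : a * l.prod = 0 := by
  induction l with
  | nil => simp at hb
  | cons x l ih =>
    rw [List.prod_cons]
    rcases List.mem_cons.1 hb with rfl | hb
    · rw [← mul_assoc, hab, zero_mul]
    · rw [← mul_assoc, hc x List.mem_cons_self, mul_assoc,
        ih (fun y hy => hc y (List.mem_cons_of_mem _ hy)) hb, mul_zero]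

theorem cov_mul_self (i : Fin 2) (j : Fin (s + 1)) : cov v i j * cov v i j = 0 :=
  ExteriorAlgebra.ι_sq_zero _

theorem cov_anticomm (i k : Fin 2) (j l : Fin (s + 1)) :
    cov v i j * cov v k l = -(cov v k l * cov v i j) :=
  eq_neg_of_add_eq_zero_left (ExteriorAlgebra.ι_add_mul_swap _ _)

/-- The factors `v_{1k} ∧ v_{2k}` have even degree, so `v_{ij}` can be moved past them to the factor
that contains it. -/
theorem E_volR (i : Fin 2) (j : Fin (s + 1)) : E v i j (volR v) = 0 := by
  refine list_prod_eq_zero (b := cov v 0 j * cov v 1 j) ?_ ?_ ?_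
  · intro x hx
    obtain ⟨k, rfl⟩ := (List.mem_ofFn' _ _).1 hx
    rw [← mul_assoc, cov_anticomm v i 0, neg_mul, mul_assoc, cov_anticomm v i 1, mul_neg, neg_neg,
      mul_assoc]
  · exact (List.mem_ofFn' _ _).2 ⟨j, rfl⟩
  · fin_cases i
    · change cov v 0 j * _ = 0
      rw [← mul_assoc, cov_mul_self, zero_mul]
    · change cov v 1 j * _ = 0
      rw [cov_anticomm v 0 1, mul_neg, ← mul_assoc, cov_mul_self, zero_mul, neg_zero]

theorem list_prod_mem (l : List (Fin (s + 1))) :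
    (l.map fun j => cov v 0 j * cov v 1 j).prod ∈ ⋀[ℝ]^(2 * l.length) M := by
  induction l with
  | nil => simp
  | cons j l ih =>
    rw [List.map_cons, List.prod_cons, List.length_cons,
      show 2 * (l.length + 1) = 1 + 1 + 2 * l.length by ring]
    have h : ∀ i j, cov v i j ∈ ⋀[ℝ]^1 M := by
      intro i j
      change _ ∈ LinearMap.range (ExteriorAlgebra.ι ℝ) ^ 1
      rw [pow_one]
      exact ⟨_, rfl⟩
    exact SetLike.mul_mem_graded (SetLike.mul_mem_graded (h _ _) (h _ _)) ih

theorem volR_eq : volR v = ((List.finRange (s + 1)).map fun j => cov v 0 j * cov v 1 j).prod := by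
  rw [volR, List.ofFn_eq_map]

theorem volR_mem : volR v ∈ ⋀[ℝ]^(2 * (s + 1)) M := by
  have h := list_prod_mem v (List.finRange (s + 1))
  rwa [← volR_eq, List.length_finRange] at h

theorem I_list_prod (i : Fin 2) (j : Fin (s + 1)) (l : List (Fin (s + 1))) (hj : j ∉ l) :
    I v i j (l.map fun j => cov v 0 j * cov v 1 j).prod = 0 := by
  induction l with
  | nil => exact contractLeft_one _
  | cons k l ih =>
    rw [List.mem_cons, not_or] at hj
    have h : ∀ k', I v i j * E v k' k = -(E v k' k * I v i j) := by
      intro k'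
      rw [I_mul_E, if_neg (by simp [Ne.symm hj.1]), zero_sub]
    have h2 : I v i j * (E v 0 k * E v 1 k) = E v 0 k * E v 1 k * I v i j := by
      rw [← mul_assoc, h, neg_mul, mul_assoc, h, mul_neg, neg_neg, mul_assoc]
    have h3 := LinearMap.congr_fun h2 (l.map fun j => cov v 0 j * cov v 1 j).prod
    simp only [Module.End.mul_apply, ih hj.2, map_zero] at h3
    rw [List.map_cons, List.prod_cons, mul_assoc]
    exact h3

theorem metric_list_prod (l : List (Fin (s + 1))) (hl : l.Nodup) :
    metric (l.map fun j => cov v 0 j * cov v 1 j).prod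
      (l.map fun j => cov v 0 j * cov v 1 j).prod = 1 := by
  induction l with
  | nil => exact metric_one_one
  | cons j l ih =>
    rw [List.nodup_cons] at hl
    set w := (l.map fun j => cov v 0 j * cov v 1 j).prod with hw
    have e : ((j :: l).map fun j => cov v 0 j * cov v 1 j).prod = E v 0 j (E v 1 j w) := by
      rw [List.map_cons, List.prod_cons, mul_assoc]; rfl
    have w0 : ∀ i, I v i j w = 0 := fun i => I_list_prod v i j l hl.1
    have h0 : I v 0 j (E v 0 j (E v 1 j w)) = E v 1 j w := by
      have h1 := LinearMap.congr_fun (I_mul_E v 0 0 j j) (E v 1 j w)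
      have h2 := LinearMap.congr_fun (I_mul_E v 0 1 j j) w
      simp [w0] at h1 h2
      rw [h1, h2]; simp
    have h1 : I v 1 j (E v 1 j w) = w := by
      have h2 := LinearMap.congr_fun (I_mul_E v 1 1 j j) w
      simpa [w0] using h2
    rw [e, metric_E, h0, metric_E, h1]
    exact ih hl.2

theorem metric_volR : metric (volR v) (volR v) = 1 := by
  rw [volR_eq]
  exact metric_list_prod v _ (List.nodup_finRange _)

theorem finrank_eq (v : OrthonormalBasis (Fin 2 × Fin (s + 1)) ℝ M) :
    Module.finrank ℝ M = 2 * (s + 1) := by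
  rw [Module.finrank_eq_card_basis v.toBasis]
  simp

/-- The coefficient of the volume form. -/
def tau : CForm M →ₗ[ℂ] ℂ where
  toFun x := hermitianMetric x (Ω v)
  map_add' := by simp
  map_smul' := by simp

theorem tau_tmul (z : ℂ) (x : RForm M) : tau v (z ⊗ₜ[ℝ] x) = z * metric x (volR v) := by
  change (metric.baseChange ℂ) (z ⊗ₜ[ℝ] x) (conj (1 ⊗ₜ[ℝ] volR v)) = _
  rw [conj_tmul, LinearMap.BilinForm.baseChange_tmul]
  simp [mul_comm]

theorem tau_Ω : tau v (Ω v) = 1 := by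
  change tau v (1 ⊗ₜ[ℝ] volR v) = 1
  rw [tau_tmul, metric_volR]; simp

/-- Contraction is adjoint to wedging, and wedging kills the volume form. This is the vanishing of
the integral of a derivative, and `tau_I_mul` is the resulting integration by parts. -/
theorem tau_I (i : Fin 2) (j : Fin (s + 1)) (x : CForm M) :
    tau v ((I v i j).baseChange ℂ x) = 0 := by
  induction x using TensorProduct.induction_on with
  | zero => simp
  | tmul z x =>
    rw [LinearMap.baseChange_tmul, tau_tmul, metric_I, E_volR]
    simp
  | add x y hx hy => simp only [map_add, hx, hy, add_zero]

theorem metric_involR_volR (x : RForm M) : metric (involR x) (volR v) = metric x (volR v) := by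
  have h : (metric.flip (volR v)) ∘ₗ (involR (M := M)).toLinearMap = metric.flip (volR v) := by
    refine linearMap_ext_ιMulti fun n a => ?_
    change metric (involR _) _ = metric _ _
    rw [involR_ιMulti, map_smul, LinearMap.smul_apply]
    by_cases hn : n = 2 * (s + 1)
    · have h1 : (-1 : ℝ) ^ n = 1 := by rw [hn, pow_mul]; simp
      rw [h1, one_smul]
    · rw [metric_of_mem_ne hn (ιMulti_mem n a) (volR_mem v), smul_zero]
  exact LinearMap.congr_fun h x

theorem tau_invol (x : CForm M) : tau v (invol x) = tau v x := by
  induction x using TensorProduct.induction_on with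
  | zero => simp
  | tmul z x => rw [invol_tmul, tau_tmul, tau_tmul, metric_involR_volR]
  | add x y hx hy => simp only [map_add, hx, hy]

theorem tau_conj (x : CForm M) : tau v (conj x) = starRingEnd ℂ (tau v x) := by
  induction x using TensorProduct.induction_on with
  | zero => simp
  | tmul z x => rw [conj_tmul, tau_tmul, tau_tmul]; simp
  | add x y hx hy => simp only [map_add, hx, hy]

/-- Only terms of even total degree `2(s+1)` pair with the volume form; on them `deg x * deg y` and
`deg y` have the same parity, so the sign of the exchange depends on `y` alone. -/
theorem metric_mul_comm_volR (x y : RForm M) :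
    metric (y * x) (volR v) = metric (x * involR y) (volR v) := by
  induction x using CliffordAlgebra.left_induction generalizing y with
  | algebraMap r =>
    change metric (y * algebraMap ℝ (RForm M) r) _ = metric (algebraMap ℝ (RForm M) r * involR y) _
    rw [← Algebra.commutes, Algebra.algebraMap_eq_smul_one, smul_mul_assoc, smul_mul_assoc,
      one_mul, one_mul, map_smul, map_smul, LinearMap.smul_apply, LinearMap.smul_apply,
      metric_involR_volR]
  | add x z hx hz => simp only [mul_add, add_mul, map_add, LinearMap.add_apply, hx, hz]
  | ι_mul x m hx =>
    change metric (y * (ExteriorAlgebra.ι ℝ m * x)) _ =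
      metric (ExteriorAlgebra.ι ℝ m * x * involR y) _
    have key : ∀ w, metric (ExteriorAlgebra.ι ℝ m * w) (volR v) =
        -metric (w * ExteriorAlgebra.ι ℝ m) (volR v) := by
      intro w
      rw [ι_mul_comm, ← metric_involR_volR, map_mul involR, involR_involR, involR_ι, mul_neg,
        map_neg, LinearMap.neg_apply]
    rw [← mul_assoc, hx, map_mul involR, involR_ι, mul_neg, mul_neg, map_neg, LinearMap.neg_apply,
      mul_assoc, key, mul_assoc]

theorem tau_mul_comm (x y : CForm M) : tau v (y * x) = tau v (x * invol y) := by
  induction x using TensorProduct.induction_on with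
  | zero => simp
  | add x z hx hz => simp only [map_add, mul_add, add_mul, hx, hz]
  | tmul z x =>
    induction y using TensorProduct.induction_on with
    | zero => simp
    | add y z hy hz => simp only [map_add, mul_add, add_mul, hy, hz]
    | tmul w y =>
      rw [invol_tmul, Algebra.TensorProduct.tmul_mul_tmul, Algebra.TensorProduct.tmul_mul_tmul,
        tau_tmul, tau_tmul, metric_mul_comm_volR, mul_comm w z]

theorem tau_E_mul (i : Fin 2) (j : Fin (s + 1)) (x y : CForm M) :
    tau v ((E v i j).baseChange ℂ x * y) = tau v (invol x * (E v i j).baseChange ℂ y) := by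
  rw [E_baseChange_apply, E_baseChange_apply, cov_mul_comm, mul_assoc]

theorem tau_I_mul (i : Fin 2) (j : Fin (s + 1)) (x y : CForm M) :
    tau v ((I v i j).baseChange ℂ x * y) = -tau v (invol x * (I v i j).baseChange ℂ y) := by
  have h := tau_I v i j (x * y)
  rw [I_baseChange_mul, map_add] at h
  exact eq_neg_of_add_eq_zero_left h

theorem tau_invol_mul (x y : CForm M) : tau v (invol x * y) = tau v (x * invol y) := by
  rw [← tau_invol, map_mul, invol_invol]

end Coframe

end HermitianForm

end SKaehler

end

noncomputable section

namespace SKaehler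

/-! ### The Hermitian form as an integral of products -/

section HermitianForm

variable {M : Type*} [NormedAddCommGroup M] [InnerProductSpace ℝ M] [FiniteDimensional ℝ M]

theorem cform_induction {P : CForm M → Prop} (zero : P 0) (add : ∀ x y, P x → P y → P (x + y))
    (mul : ∀ z n (a : Fin n → M), P (z ⊗ₜ[ℝ] ExteriorAlgebra.ιMulti ℝ n a)) (x : CForm M) :
    P x := by
  induction x using TensorProduct.induction_on with
  | zero => exact zero
  | add x y hx hy => exact add x y hx hy
  | tmul z x =>
    have hx : x ∈ Submodule.span ℝ
        (Set.range fun x : Σ n, (Fin n → M) => ExteriorAlgebra.ιMulti ℝ x.1 x.2) := by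
      rw [ExteriorAlgebra.ιMulti_span ℝ M]; trivial
    induction hx using Submodule.span_induction generalizing z with
    | mem x hx => obtain ⟨⟨n, a⟩, rfl⟩ := hx; exact mul z n a
    | zero => rw [TensorProduct.tmul_zero]; exact zero
    | add x y _ _ hx hy => rw [TensorProduct.tmul_add]; exact add _ _ (hx z) (hy z)
    | smul r x _ hx => rw [← TensorProduct.smul_tmul]; exact hx _

theorem ccomponent_tmul_of_mem {n : ℕ} {x : RForm M} (hx : x ∈ ⋀[ℝ]^n M) (z : ℂ) :
    ccomponent n (z ⊗ₜ[ℝ] x) = z ⊗ₜ[ℝ] x := by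
  rw [ccomponent, LinearMap.baseChange_tmul, LinearMap.comp_apply, component_of_mem hx]
  rfl

theorem ccomponent_tmul_of_mem_ne {n k : ℕ} (h : n ≠ k) {x : RForm M} (hx : x ∈ ⋀[ℝ]^n M)
    (z : ℂ) : ccomponent k (z ⊗ₜ[ℝ] x) = 0 := by
  rw [ccomponent, LinearMap.baseChange_tmul, LinearMap.comp_apply, component_of_mem_ne h hx,
    map_zero, TensorProduct.tmul_zero]

variable {s : ℕ} (v : OrthonormalBasis (Fin 2 × Fin (s + 1)) ℝ M)

theorem form_apply (α β : CForm M) :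
    form v α β = ∑ a ∈ Finset.range (Module.finrank ℝ M + 1),
      ∑ b ∈ Finset.range (Module.finrank ℝ M + 1),
        Complex.I ^ (a * b) * tau v (ccomponent a α * conj (ccomponent b β)) := by
  simp only [form, LinearMap.sum_apply, LinearMap.mk₂'ₛₗ_apply]
  rfl

theorem tau_tmul_of_mem_ne {n : ℕ} (hn : n ≠ 2 * (s + 1)) {x : RForm M} (hx : x ∈ ⋀[ℝ]^n M)
    (z : ℂ) : tau v (z ⊗ₜ[ℝ] x) = 0 := by
  rw [tau_tmul, metric_of_mem_ne hn hx (volR_mem v)]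
  simp

/-- The phase of the Hermitian form on forms of odd degree. -/
def phase (s : ℕ) : ℂ := (-1) ^ s * Complex.I

theorem phase_mul_self : phase s * phase s = -1 := by
  have h : ((-1 : ℂ) ^ s) * (-1) ^ s = 1 := by rw [← mul_pow]; simp
  rw [phase, mul_mul_mul_comm, h, Complex.I_mul_I, one_mul]

theorem conj_phase : starRingEnd ℂ (phase s) = -phase s := by
  simp [phase]

/-- The operator that is the identity on even forms and multiplies odd forms by `z`. -/
def parityScale (z : ℂ) : CForm M →ₗ[ℂ] CForm M :=
  ((1 + z) / 2) • LinearMap.id + ((1 - z) / 2) • invol.toLinearMap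

theorem parityScale_apply (z : ℂ) (x : CForm M) :
    parityScale z x = ((1 + z) / 2) • x + ((1 - z) / 2) • invol x := rfl

theorem I_pow_four_mul (n : ℕ) : Complex.I ^ (4 * n) = 1 := by
  rw [pow_mul, Complex.I_pow_four, one_pow]

/-- Only degrees `n + k = 2(s+1)` contribute, so both are even or both odd. In the even case `i^{nk}
= 1`. For `n = 2l+1`, `k = 2m+1` one has `l + m = s` and `i^{nk} = (-1)^s i`, which depends only on
the parity. Thus the degree-dependent factor becomes the single operator `parityScale` on the second
argument. -/
theorem form_eq (α β : CForm M) :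
    form v α β = tau v (α * parityScale (phase s) (conj β)) := by
  induction α using cform_induction with
  | zero => simp
  | add x y hx hy => rw [map_add, LinearMap.add_apply, hx, hy, add_mul, map_add]
  | mul z n a =>
    induction β using cform_induction with
    | zero => simp
    | add x y hx hy => rw [map_add, hx, hy, map_add, map_add, mul_add, map_add]
    | mul w k b =>
      set x := ExteriorAlgebra.ιMulti ℝ n a with hxdef
      set y := ExteriorAlgebra.ιMulti ℝ k b with hydef
      have hx : x ∈ ⋀[ℝ]^n M := ιMulti_mem n a
      have hy : y ∈ ⋀[ℝ]^k M := ιMulti_mem k b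
      have hxy : x * y ∈ ⋀[ℝ]^(n + k) M := SetLike.mul_mem_graded hx hy
      have hinv : invol (conj (w ⊗ₜ[ℝ] y)) = ((-1) ^ k : ℂ) • conj (w ⊗ₜ[ℝ] y) := by
        rw [conj_tmul, invol_tmul, hydef, involR_ιMulti, TensorProduct.tmul_smul]
        rcases Nat.even_or_odd k with h | h <;> simp [h.neg_one_pow]
      have hprod : z ⊗ₜ[ℝ] x * conj (w ⊗ₜ[ℝ] y) = (z * starRingEnd ℂ w) ⊗ₜ[ℝ] (x * y) := by
        rw [conj_tmul, Algebra.TensorProduct.tmul_mul_tmul]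
      rw [form_apply, parityScale_apply, hinv, smul_smul, ← add_smul, mul_smul_comm, map_smul,
        smul_eq_mul]
      by_cases hnk : n + k = 2 * (s + 1)
      · rw [finrank_eq v, Finset.sum_eq_single n, Finset.sum_eq_single k]
        · rw [ccomponent_tmul_of_mem hx, ccomponent_tmul_of_mem hy]
          congr 1
          rcases Nat.even_or_odd k with h | h
          · rw [h.neg_one_pow]
            obtain ⟨m, hm⟩ := h
            obtain ⟨l, hl⟩ : ∃ l, n = 2 * l := ⟨s + 1 - m, by omega⟩
            rw [hl, hm, show 2 * l * (m + m) = 4 * (l * m) by ring, I_pow_four_mul]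
            ring
          · rw [h.neg_one_pow]
            obtain ⟨m, hm⟩ := h
            obtain ⟨l, hl⟩ : ∃ l, n = 2 * l + 1 := ⟨s - m, by omega⟩
            have hs : s = l + m := by omega
            rw [hl, hm, show (2 * l + 1) * (2 * m + 1) = 4 * (l * m) + 2 * s + 1 by rw [hs]; ring,
              pow_add, pow_add, I_pow_four_mul, pow_mul, Complex.I_sq, pow_one, one_mul, phase]
            ring
        · intro c _ hc
          rw [ccomponent_tmul_of_mem_ne hc.symm hy]
          simp
        · intro h
          exact absurd (Finset.mem_range.2 (by omega)) h
        · intro c _ hc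
          refine Finset.sum_eq_zero fun d _ => ?_
          rw [ccomponent_tmul_of_mem_ne hc.symm hx]
          simp
        · intro h
          exact absurd (Finset.mem_range.2 (by omega)) h
      · rw [hprod, tau_tmul_of_mem_ne v hnk hxy, mul_zero]
        refine Finset.sum_eq_zero fun c _ => Finset.sum_eq_zero fun d _ => ?_
        by_cases hc : n = c
        · by_cases hd : k = d
          · subst hc hd
            rw [ccomponent_tmul_of_mem hx, ccomponent_tmul_of_mem hy, hprod,
              tau_tmul_of_mem_ne v hnk hxy, mul_zero]
          · rw [ccomponent_tmul_of_mem_ne hd hy]; simp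
        · rw [ccomponent_tmul_of_mem_ne hc hx]; simp

theorem tau_parityScale_mul (z : ℂ) (x y : CForm M) :
    tau v (parityScale z x * y) = tau v (x * parityScale z y) := by
  simp only [parityScale_apply, add_mul, mul_add, smul_mul_assoc, mul_smul_comm, map_add,
    map_smul, tau_invol_mul]

theorem parityScale_invol (z : ℂ) (x : CForm M) :
    parityScale z (invol x) = parityScale (-z) x := by
  rw [parityScale_apply, parityScale_apply, invol_invol, add_comm, sub_neg_eq_add, ← sub_eq_add_neg]

theorem conj_parityScale (z : ℂ) (x : CForm M) :
    conj (parityScale z x) = parityScale (starRingEnd ℂ z) (conj x) := by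
  have h2 : starRingEnd ℂ 2 = 2 := Complex.conj_ofNat 2
  rw [parityScale_apply, parityScale_apply, map_add, map_smulₛₗ, map_smulₛₗ, conj_invol]
  simp [h2]

theorem parityScale_parityScale {z w : ℂ} (h : z * w = 1) (x : CForm M) :
    parityScale z (parityScale w x) = x := by
  simp only [parityScale_apply, map_add, map_smul, invol_invol]
  match_scalars
  · linear_combination (1 / 2) * h
  · linear_combination (-1 / 2) * h

/-- The natural form is Hermitian. -/
theorem form_hermitian (α β : CForm M) : form v β α = starRingEnd ℂ (form v α β) := by
  -- Exchanging the factors costs a grading involution, which changes `phase` into `-phase`; this is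
  -- its complex conjugate because the phase is imaginary.
  rw [form_eq, form_eq, tau_mul_comm, tau_parityScale_mul, parityScale_invol, ← tau_conj,
    conj_mul, conj_parityScale, conj_conj, conj_phase]

/-! ### Invariance -/

theorem tau_neg_mul (x y : CForm M) : tau v (-x * y) = -tau v (x * y) :=
  map_neg (tau v ∘ₗ LinearMap.mulRight ℂ y) x

/-- A real operator on real forms that preserves parity and is symmetric for integration of
products. -/
structure IsTauSymmetric (T : Module.End ℝ (RForm M)) : Prop where
  invol : ∀ x, invol (T.baseChange ℂ x) = T.baseChange ℂ (invol x)
  symm : ∀ x y, tau v (T.baseChange ℂ x * y) = tau v (x * T.baseChange ℂ y)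

theorem IsTauSymmetric.add {S T : Module.End ℝ (RForm M)} (hS : IsTauSymmetric v S)
    (hT : IsTauSymmetric v T) : IsTauSymmetric v (S + T) where
  invol x := by simp only [LinearMap.baseChange_add, LinearMap.add_apply, map_add, hS.invol,
    hT.invol]
  symm x y := by simp only [LinearMap.baseChange_add, LinearMap.add_apply, map_add, add_mul,
    mul_add, hS.symm, hT.symm]

/-- Moving the two factors across one at a time reverses their order and produces one sign from the
grading involution; anticommuting them back cancels it. For contractions the two additional signs
cancel each other. -/
theorem isTauSymmetric_E_mul_E (i k : Fin 2) (j l : Fin (s + 1)) :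
    IsTauSymmetric v (E v i j * E v k l) where
  invol x := by
    simp only [LinearMap.baseChange_mul, Module.End.mul_apply, invol_E_baseChange, map_neg,
      neg_neg]
  symm x y := by
    rw [LinearMap.baseChange_mul, Module.End.mul_apply, tau_E_mul, invol_E_baseChange, tau_neg_mul,
      tau_E_mul, invol_invol, E_baseChange_anticomm, LinearMap.neg_apply, Module.End.mul_apply]
    exact (map_neg (tau v ∘ₗ LinearMap.mulLeft ℂ x) _).symm

theorem isTauSymmetric_I_mul_I (i k : Fin 2) (j l : Fin (s + 1)) :
    IsTauSymmetric v (I v i j * I v k l) where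
  invol x := by
    simp only [LinearMap.baseChange_mul, Module.End.mul_apply, invol_I_baseChange, map_neg,
      neg_neg]
  symm x y := by
    rw [LinearMap.baseChange_mul, Module.End.mul_apply, tau_I_mul, invol_I_baseChange, tau_neg_mul,
      tau_I_mul, invol_invol, neg_neg, I_baseChange_anticomm, LinearMap.neg_apply,
      Module.End.mul_apply]
    exact (map_neg (tau v ∘ₗ LinearMap.mulLeft ℂ x) _).symm

theorem isTauSymmetric_of_mem_generators {T : Module.End ℝ (RForm M)} (hT : T ∈ generators v) :
    IsTauSymmetric v T := by
  rcases hT with ⟨j, k, _, rfl | rfl⟩ | ⟨j, rfl | rfl⟩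
  · rw [L_eq, Fin.sum_univ_two]
    exact (isTauSymmetric_E_mul_E v _ _ _ _).add v (isTauSymmetric_E_mul_E v _ _ _ _)
  · rw [adj_L, Fin.sum_univ_two]
    exact (isTauSymmetric_I_mul_I v _ _ _ _).add v (isTauSymmetric_I_mul_I v _ _ _ _)
  · rw [V_eq]; exact isTauSymmetric_E_mul_E v _ _ _ _
  · rw [adj_V]; exact isTauSymmetric_I_mul_I v _ _ _ _

/-- `T` commutes with conjugation and with `parityScale`, hence is symmetric for the form; the
factor `i` changes sign in the conjugate-linear slot. -/
theorem IsTauSymmetric.preserves {T : Module.End ℝ (RForm M)} (hT : IsTauSymmetric v T) :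
    Preserves (form v) (Complex.I • T.baseChange ℂ) := by
  intro α β
  rw [form_eq, form_eq, LinearMap.smul_apply, LinearMap.smul_apply, smul_mul_assoc, map_smul,
    hT.symm, map_smulₛₗ, conj_baseChange, map_smul, mul_smul_comm, map_smul]
  have h : parityScale (phase s) (T.baseChange ℂ (conj β)) =
      T.baseChange ℂ (parityScale (phase s) (conj β)) := by
    simp only [parityScale_apply, hT.invol, map_add, map_smul]
  rw [h]
  simp

theorem preserves_of_mem_uL {x : Module.End ℂ (CForm M)} (hx : x ∈ uL v) :
    Preserves (form v) x := by
  induction hx using LieSubalgebra.lieSpan_induction with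
  | mem x h =>
    obtain ⟨T, hT, rfl⟩ := h
    exact (isTauSymmetric_of_mem_generators v hT).preserves v
  | zero => intro α β; simp
  | add x y _ _ hx hy =>
    intro α β
    simp only [LinearMap.add_apply, map_add]
    linear_combination hx α β + hy α β
  | smul r x _ hx =>
    intro α β
    have h : ∀ α, (r • x) α = (r : ℂ) • x α := fun _ => rfl
    rw [h, h, map_smul, LinearMap.smul_apply, map_smulₛₗ, Complex.conj_ofReal, ← smul_add, hx,
      smul_zero]
  | lie x y _ _ hx hy =>
    intro α β
    simp only [Ring.lie_def, LinearMap.sub_apply, Module.End.mul_apply, map_sub]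
    linear_combination hx (y α) β - hy α (x β) - hy (x α) β + hx α (y β)

/-! ### Nondegeneracy -/

/-- The radical of the pairing of complex forms by integration of products. -/
def radical : Submodule ℂ (CForm M) where
  carrier := {x | ∀ y, tau v (x * y) = 0}
  add_mem' := by
    intro x y hx hy z
    rw [add_mul, map_add, hx, hy, add_zero]
  zero_mem' := by simp
  smul_mem' := by
    intro c x hx y
    rw [smul_mul_assoc, map_smul, hx, smul_zero]

theorem invol_mem_radical {x : CForm M} (hx : x ∈ radical v) : invol x ∈ radical v := by
  intro y
  rw [tau_invol_mul, hx]

theorem E_mem_radical (i : Fin 2) (j : Fin (s + 1)) {x : CForm M} (hx : x ∈ radical v) :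
    (E v i j).baseChange ℂ x ∈ radical v := by
  intro y
  rw [tau_E_mul, invol_mem_radical v hx]

theorem I_mem_radical (i : Fin 2) (j : Fin (s + 1)) {x : CForm M} (hx : x ∈ radical v) :
    (I v i j).baseChange ℂ x ∈ radical v := by
  intro y
  rw [tau_I_mul, invol_mem_radical v hx, neg_zero]

theorem creation_mem_radical (p : Fin (s + 1) ⊕ Fin (s + 1)) {x : CForm M}
    (hx : x ∈ radical v) : creation v p x ∈ radical v := by
  rcases p with j | j
  · exact add_mem (E_mem_radical v _ _ hx) (Submodule.smul_mem _ _ (E_mem_radical v _ _ hx))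
  · exact Submodule.smul_mem _ _
      (add_mem (I_mem_radical v _ _ hx) (Submodule.smul_mem _ _ (I_mem_radical v _ _ hx)))

theorem annihilation_mem_radical (p : Fin (s + 1) ⊕ Fin (s + 1)) {x : CForm M}
    (hx : x ∈ radical v) : annihilation v p x ∈ radical v := by
  rcases p with j | j
  · exact Submodule.smul_mem _ _
      (add_mem (I_mem_radical v _ _ hx) (Submodule.smul_mem _ _ (I_mem_radical v _ _ hx)))
  · exact add_mem (E_mem_radical v _ _ hx) (Submodule.smul_mem _ _ (E_mem_radical v _ _ hx))

theorem Ω_notMem_radical : Ω v ∉ radical v := by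
  intro h
  have h1 := h 1
  rw [mul_one, tau_Ω] at h1
  exact one_ne_zero h1

/-- Conjugation and `parityScale` are invertible, the inverse of `phase` being `-phase`, so every
`y` occurs as the transformed second argument. -/
theorem mem_radical_of_form_eq_zero {x : CForm M} (h : ∀ β, form v x β = 0) : x ∈ radical v := by
  intro y
  have h1 := h (conj (parityScale (-phase s) y))
  rwa [form_eq, conj_conj, parityScale_parityScale] at h1
  rw [mul_neg, phase_mul_self, neg_neg]

/-- An element of `𝐮𝓛^s` whose image is orthogonal to all forms is zero. -/
theorem eq_zero_of_form_eq_zero (hs : 2 ≤ s) {x : Module.End ℂ (CForm M)} (hx : x ∈ uL v)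
    (h : ∀ α β, form v (x α) β = 0) : x = 0 := by
  obtain ⟨X, rfl⟩ := exists_rho_of_mem_uL v hs hx
  have hr : ∀ w, rho v X w ∈ radical v := fun w => mem_radical_of_form_eq_zero v (h w)
  suffices X = 0 by rw [this, map_zero]
  ext p q
  by_contra hpq
  -- Every term on the left lies in the radical, which is stable under `c` and `d` and contains the
  -- image of `rho X`; hence `X p q • Ω` does too.
  have key := LinearMap.congr_fun ((isCAR v).anticommutator_lie X p q) (Ω v)
  refine Ω_notMem_radical v (((radical v).smul_mem_iff hpq).1 ?_)
  change X p q • (1 : Module.End ℂ (CForm M)) (Ω v) ∈ radical v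
  rw [← LinearMap.smul_apply, ← key]
  refine add_mem (annihilation_mem_radical v _ ?_) ?_
  · exact sub_mem (hr _) (creation_mem_radical v _ (hr _))
  · exact sub_mem (hr _) (creation_mem_radical v _ (hr _))

/-- With `a = ⟨xα, β⟩` and `b = ⟨α, xβ⟩`, the two conditions read `a + b = 0` and `i a - i b = 0`.
-/
theorem form_eq_zero_of_smul_I_preserves {x : Module.End ℂ (CForm M)}
    (h : Preserves (form v) x) (h' : Preserves (form v) (Complex.I • x)) (α β : CForm M) :
    form v (x α) β = 0 := by
  have h1 := h α β
  have h2 := h' α β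
  rw [LinearMap.smul_apply, LinearMap.smul_apply, map_smul, LinearMap.smul_apply, map_smulₛₗ,
    Complex.conj_I, smul_eq_mul, smul_eq_mul] at h2
  linear_combination (1 / 2) * h1 - (Complex.I / 2) * h2 +
    ((form v (x α) β - form v α (x β)) / 2) * Complex.I_sq

/-- `𝐮𝓛^s` is a real form of `𝓛^s_ℂ`. -/
theorem isRealForm_uL (hs : 2 ≤ s) : IsRealForm (uL v) (LC v) :=
  ⟨span_uL v, fun _ hx hIx => eq_zero_of_form_eq_zero v hs hx
    (form_eq_zero_of_smul_I_preserves v (preserves_of_mem_uL v hx) (preserves_of_mem_uL v hIx))⟩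

/-- `𝐮𝓛^s` consists of the elements of `𝓛^s_ℂ` that preserve the Hermitian form. -/
theorem uL_eq_preserves (hs : 2 ≤ s) :
    (uL v : Set (Module.End ℂ (CForm M))) = {φ | φ ∈ LC v ∧ Preserves (form v) φ} := by
  refine Set.Subset.antisymm (fun x hx => ⟨uL_le_LC v hx, preserves_of_mem_uL v hx⟩) ?_
  rintro x ⟨hx, hp⟩
  obtain ⟨a, ha, b, hb, rfl⟩ := exists_add_of_mem_LC v hx
  have hIb : Preserves (form v) (Complex.I • b) := by
    intro α β
    have h1 := hp α β
    have h2 := preserves_of_mem_uL v ha α β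
    simp only [LinearMap.add_apply, map_add] at h1
    linear_combination h1 - h2
  have hb0 := eq_zero_of_form_eq_zero v hs hb
    (form_eq_zero_of_smul_I_preserves v (preserves_of_mem_uL v hb) hIb)
  rw [hb0, smul_zero, add_zero]
  exact ha

end HermitianForm

end SKaehler

end

noncomputable section

namespace SKaehler

/-! ### Fillings in the oscillator representation -/

section Filling

variable {W : Type*} [AddCommGroup W] [Module ℂ W]

/-- The eigenvalues of a sum of commuting idempotents are natural numbers. -/
theorem eq_zero_of_sum_idempotent {ι : Type*} [DecidableEq ι] {m : ι → Module.End ℂ W}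
    (hi : ∀ p x, m p (m p x) = m p x) (hc : ∀ p q x, m p (m q x) = m q (m p x)) (S : Finset ι)
    {z : ℂ} (hz : ∀ k : ℕ, z ≠ k) {y : W} (hy : ∑ p ∈ S, m p y = z • y) : y = 0 := by
  induction S using Finset.induction_on generalizing z y with
  | empty =>
    rw [Finset.sum_empty] at hy
    exact (smul_eq_zero.1 hy.symm).resolve_left (by simpa using hz 0)
  | insert p S hp ih =>
    rw [Finset.sum_insert hp] at hy
    have hS : ∑ q ∈ S, m q y = z • y - m p y := eq_sub_of_add_eq' hy
    have hSm : ∑ q ∈ S, m q (m p y) = z • m p y - m p y := by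
      have h := congrArg (m p) hS
      rw [map_sum, map_sub, map_smul, hi] at h
      rw [← h]
      exact Finset.sum_congr rfl fun q _ => hc q p y
    -- On `m p y` the remaining idempotents sum to `z - 1`, again not a natural number; once `m p y
    -- = 0`, they sum to `z` on `y` itself.
    have h1 : m p y = 0 := by
      refine ih (z := z - 1) (fun k hk => hz (k + 1) ?_) ?_
      · push_cast
        linear_combination hk
      · rw [hSm, sub_smul, one_smul]
    refine ih hz ?_
    rw [hS, h1, sub_zero]

variable {ι : Type*} [Fintype ι] [DecidableEq ι] {c d : ι → Module.End ℂ W} (h : IsCAR c d)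

namespace IsCAR

include h

theorem c_c (p q : ι) (x : W) : c p (c q x) = -c q (c p x) := LinearMap.congr_fun (h.cc p q) x

theorem d_d (p q : ι) (x : W) : d p (d q x) = -d q (d p x) := LinearMap.congr_fun (h.dd p q) x

theorem d_c_self (p : ι) (x : W) : d p (c p x) = x - c p (d p x) := by
  simpa using LinearMap.congr_fun (h.dc p p) x

theorem d_c_of_ne {p q : ι} (hpq : p ≠ q) (x : W) : d p (c q x) = -c q (d p x) := by
  simpa [hpq] using LinearMap.congr_fun (h.dc p q) x

theorem c_c_self (p : ι) (x : W) : c p (c p x) = 0 := eq_zero_of_eq_neg (h.c_c p p x)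

theorem d_d_self (p : ι) (x : W) : d p (d p x) = 0 := eq_zero_of_eq_neg (h.d_d p p x)

theorem c_d_c (p : ι) (x : W) : c p (d p (c p x)) = c p x := by
  rw [h.d_c_self, map_sub, h.c_c_self, sub_zero]

/-- An eigenvector of `∑ d_p c_p` with eigenvalue one is a sum of vectors `d_p y` such that `y` is
annihilated by all `c_q`. -/
theorem exists_sum_of_sum_eq_self {x : W} (hx : ∑ p, d p (c p x) = x) :
    ∃ y : ι → W, (∀ p q, c q (y p) = 0) ∧ x = ∑ p, d p (y p) := by
  set m : ι → Module.End ℂ W := fun p => d p * c p with hm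
  have mi : ∀ p x, m p (m p x) = m p x := fun p x => by
    simp only [hm, Module.End.mul_apply, h.c_d_c]
  have mc : ∀ p q x, m p (m q x) = m q (m p x) := by
    intro p q x
    by_cases hpq : p = q
    · rw [hpq]
    have e1 : c p (d q (c q x)) = d q (c q (c p x)) := by
      rw [← neg_eq_iff_eq_neg.2 (h.d_c_of_ne (Ne.symm hpq) (c q x)), h.c_c p q x, map_neg, neg_neg]
    have e2 : c q (d p (c p x)) = d p (c p (c q x)) := by
      rw [← neg_eq_iff_eq_neg.2 (h.d_c_of_ne hpq (c p x)), h.c_c q p x, map_neg, neg_neg]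
    simp only [hm, Module.End.mul_apply]
    rw [e1, e2, h.d_d, h.c_c p q x]
    simp
  have key : ∀ p q, p ≠ q → m q (m p x) = 0 := by
    intro p q hpq
    -- On `m q (m p x)` the full sum is `1` and the terms `p`, `q` contribute `1` each, so the
    -- others would have eigenvalue `-1`.
    refine eq_zero_of_sum_idempotent mi mc ((Finset.univ.erase p).erase q) (z := -1) ?_ ?_
    · intro k hk
      have h1 := congrArg Complex.re hk
      simp at h1
      have h2 : (0 : ℝ) ≤ k := Nat.cast_nonneg k
      linarith
    · have e : ∑ r, m r (m q (m p x)) = m q (m p x) := by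
        have e1 := congrArg (fun x => m q (m p x)) hx
        simp only [map_sum] at e1
        conv_rhs => rw [← e1]
        refine Finset.sum_congr rfl fun r _ => ?_
        rw [mc r q, mc r p]
        rfl
      rw [← Finset.add_sum_erase _ _ (Finset.mem_univ p),
        ← Finset.add_sum_erase (Finset.univ.erase p) _
          (Finset.mem_erase.2 ⟨hpq.symm, Finset.mem_univ q⟩), mi, mc p q, mi] at e
      rw [neg_one_smul]
      have e2 := sub_eq_zero.2 e
      rw [← add_eq_zero_iff_eq_neg, ← e2]
      abel
  refine ⟨fun p => c p x, fun p q => ?_, hx.symm⟩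
  by_cases hpq : p = q
  · rw [hpq, h.c_c_self]
  -- `c q = c q d q c q`, so this is `c q` applied to the vanishing vector `m q (m p x)`.
  have e1 : c q (m p x) = 0 := by
    have e2 := congrArg (c q) (key p q hpq)
    rwa [map_zero, hm, Module.End.mul_apply, h.c_d_c] at e2
  have e3 := h.c_c q p (d p (c p x))
  rw [h.c_d_c] at e3
  rw [e3]
  exact (congrArg (fun x => -c p x) e1).trans (by simp)

end IsCAR

end Filling

/-! ### The signature on the weight space -/

section Signature

/-- Vectors with diagonal Gram matrix `(1, …, 1, -1, …, -1)` span a nondegenerate subspace of the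
corresponding signature. -/
theorem hasSignature_span {W : Type*} [AddCommGroup W] [Module ℂ W] {f : W →ₗ[ℂ] W →ₗ⋆[ℂ] ℂ}
    {p q : ℕ} {b : Fin p ⊕ Fin q → W}
    (hb : ∀ i j, f (b i) (b j) = LieAlgebra.Orthogonal.indefiniteDiagonal (Fin p) (Fin q) ℂ i j) :
    HasSignature f (Submodule.span ℂ (Set.range b)) p q := by
  have hli : LinearIndependent ℂ b := by
    rw [Fintype.linearIndependent_iff]
    intro g hg i
    have h1 := congrArg (fun x => f x (b i)) hg
    simp only [map_sum, LinearMap.sum_apply, map_smul, LinearMap.smul_apply, hb, map_zero,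
      LinearMap.zero_apply, LieAlgebra.Orthogonal.indefiniteDiagonal, Matrix.diagonal_apply,
      smul_eq_mul, mul_ite, mul_zero, Finset.sum_ite_eq', Finset.mem_univ, if_true] at h1
    rcases i with i | i <;> simpa using h1
  refine ⟨Module.Basis.span hli, fun i j => ?_⟩
  rw [Module.Basis.span_apply, Module.Basis.span_apply, hb]

variable {M : Type*} [NormedAddCommGroup M] [InnerProductSpace ℝ M] [FiniteDimensional ℝ M]

/-- The real part of a complex form. -/
def rePart : CForm M →ₗ[ℝ] RForm M :=
  (TensorProduct.lid ℝ (RForm M)).toLinearMap ∘ₗ LinearMap.rTensor (RForm M) Complex.reLm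

/-- The imaginary part of a complex form. -/
def imPart : CForm M →ₗ[ℝ] RForm M :=
  (TensorProduct.lid ℝ (RForm M)).toLinearMap ∘ₗ LinearMap.rTensor (RForm M) Complex.imLm

theorem rePart_tmul (z : ℂ) (x : RForm M) : rePart (z ⊗ₜ[ℝ] x) = z.re • x := by
  simp [rePart]

theorem imPart_tmul (z : ℂ) (x : RForm M) : imPart (z ⊗ₜ[ℝ] x) = z.im • x := by
  simp [imPart]

theorem eq_rePart_add_imPart (x : CForm M) :
    x = 1 ⊗ₜ[ℝ] rePart x + Complex.I ⊗ₜ[ℝ] imPart x := by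
  induction x using TensorProduct.induction_on with
  | zero => simp
  | tmul z x =>
    rw [rePart_tmul, imPart_tmul, ← TensorProduct.smul_tmul, ← TensorProduct.smul_tmul,
      ← TensorProduct.add_tmul]
    congr 1
    apply Complex.ext <;> simp
  | add x y hx hy =>
    rw [map_add, map_add, TensorProduct.tmul_add, TensorProduct.tmul_add]
    nth_rewrite 1 [hx, hy]
    abel

theorem rePart_baseChange (T : Module.End ℝ (RForm M)) (x : CForm M) :
    rePart (T.baseChange ℂ x) = T (rePart x) := by
  induction x using TensorProduct.induction_on with
  | zero => simp
  | tmul z x => rw [LinearMap.baseChange_tmul, rePart_tmul, rePart_tmul, map_smul]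
  | add x y hx hy => simp only [map_add, hx, hy]

theorem imPart_baseChange (T : Module.End ℝ (RForm M)) (x : CForm M) :
    imPart (T.baseChange ℂ x) = T (imPart x) := by
  induction x using TensorProduct.induction_on with
  | zero => simp
  | tmul z x => rw [LinearMap.baseChange_tmul, imPart_tmul, imPart_tmul, map_smul]
  | add x y hx hy => simp only [map_add, hx, hy]

variable {s : ℕ} (v : OrthonormalBasis (Fin 2 × Fin (s + 1)) ℝ M)

theorem exists_smul_one_of_I_eq_zero {x : RForm M} (h : ∀ i j, I v i j x = 0) :
    ∃ r : ℝ, x = r • 1 := by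
  refine ⟨metric 1 x, ?_⟩
  rw [← Algebra.algebraMap_eq_smul_one]
  refine eq_algebraMap_of_contractLeft_eq_zero fun m => ?_
  have hm : innerₗ M m = ∑ i, inner ℝ (v i) m • v.toBasis.coord i := by
    simp only [coord_eq_innerₗ, ← map_smul, ← map_sum]
    rw [v.sum_repr' m]
  rw [hm, map_sum, LinearMap.sum_apply]
  refine Finset.sum_eq_zero fun i _ => ?_
  rw [map_smul, LinearMap.smul_apply]
  exact (congrArg _ (h i.1 i.2)).trans (smul_zero _)

theorem exists_smul_one_of_I_baseChange_eq_zero {x : CForm M}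
    (h : ∀ i j, (I v i j).baseChange ℂ x = 0) : ∃ z : ℂ, x = z • 1 := by
  obtain ⟨a, ha⟩ := exists_smul_one_of_I_eq_zero v (x := rePart x) fun i j => by
    rw [← rePart_baseChange, h, map_zero]
  obtain ⟨b, hb⟩ := exists_smul_one_of_I_eq_zero v (x := imPart x) fun i j => by
    rw [← imPart_baseChange, h, map_zero]
  refine ⟨a + b * Complex.I, ?_⟩
  rw [eq_rePart_add_imPart x, ha, hb, ← TensorProduct.smul_tmul, ← TensorProduct.smul_tmul,
    ← TensorProduct.add_tmul, Algebra.TensorProduct.one_def, TensorProduct.smul_tmul']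
  congr 1
  simp

/-! ### The maximal form of type `z_0 ∧ ⋯ ∧ z_s` -/

/-- The product of the creation operators of the listed `z_j`. -/
def creationProd (l : List (Fin (s + 1))) : Module.End ℂ (CForm M) :=
  (l.map fun j => creation v (Sum.inl j)).prod

/-- The form `z_0 ∧ ⋯ ∧ z_s`. -/
def topZ : CForm M := creationProd v (List.finRange (s + 1)) 1

theorem creationProd_cons (j : Fin (s + 1)) (l : List (Fin (s + 1))) (x : CForm M) :
    creationProd v (j :: l) x = creation v (Sum.inl j) (creationProd v l x) := by
  simp [creationProd]

theorem creationProd_concat (l : List (Fin (s + 1))) (j : Fin (s + 1)) (x : CForm M) :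
    creationProd v (l ++ [j]) x = creationProd v l (creation v (Sum.inl j) x) := by
  simp [creationProd]

theorem I_baseChange_one (i : Fin 2) (j : Fin (s + 1)) : (I v i j).baseChange ℂ 1 = 0 := by
  rw [Algebra.TensorProduct.one_def, LinearMap.baseChange_tmul]
  exact (congrArg _ (contractLeft_one _)).trans (TensorProduct.tmul_zero _ _)

theorem creation_inr_one (j : Fin (s + 1)) : creation v (Sum.inr j) 1 = 0 := by
  simp [creation, contractC, I_baseChange_one]

theorem annihilation_inl_one (j : Fin (s + 1)) : annihilation v (Sum.inl j) 1 = 0 := by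
  simp [annihilation, contractC, I_baseChange_one]

theorem creation_inr_creationProd (j : Fin (s + 1)) (l : List (Fin (s + 1))) :
    creation v (Sum.inr j) (creationProd v l 1) = 0 := by
  induction l with
  | nil => exact creation_inr_one v j
  | cons k l ih => rw [creationProd_cons, (isCAR v).c_c, ih, map_zero, neg_zero]

theorem creation_inl_creationProd {j : Fin (s + 1)} {l : List (Fin (s + 1))} (hj : j ∈ l) :
    creation v (Sum.inl j) (creationProd v l 1) = 0 := by
  induction l with
  | nil => simp at hj
  | cons k l ih =>
    rw [creationProd_cons]
    rcases List.mem_cons.1 hj with rfl | hj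
    · exact (isCAR v).c_c_self _ _
    · rw [(isCAR v).c_c, ih hj, map_zero, neg_zero]

theorem annihilation_inl_creationProd {j : Fin (s + 1)} {l : List (Fin (s + 1))} (hj : j ∉ l) :
    annihilation v (Sum.inl j) (creationProd v l 1) = 0 := by
  induction l with
  | nil => exact annihilation_inl_one v j
  | cons k l ih =>
    rw [List.mem_cons, not_or] at hj
    rw [creationProd_cons, (isCAR v).d_c_of_ne (by simpa using hj.1), ih hj.2, map_zero, neg_zero]

theorem creation_topZ (p : Fin (s + 1) ⊕ Fin (s + 1)) : creation v p (topZ v) = 0 := by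
  rcases p with j | j
  · exact creation_inl_creationProd v (List.mem_finRange j)
  · exact creation_inr_creationProd v j _

/-- Annihilation operators preserve the radical and strip the factors `z_j` one by one down to `1`,
which pairs with `Ω` to `1`. -/
theorem topZ_notMem_radical : topZ v ∉ radical v := by
  have key : ∀ l : List (Fin (s + 1)), l.Nodup → creationProd v l 1 ∉ radical v := by
    intro l hl
    induction l with
    | nil =>
      intro h
      have h1 := h (Ω v)
      change tau v (1 * Ω v) = 0 at h1
      rw [one_mul, tau_Ω] at h1
      exact one_ne_zero h1
    | cons j l ih =>
      rw [List.nodup_cons] at hl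
      intro h
      refine ih hl.2 ?_
      have h1 := annihilation_mem_radical v (Sum.inl j) h
      rwa [creationProd_cons, (isCAR v).d_c_self, annihilation_inl_creationProd v hl.1, map_zero,
        sub_zero] at h1
  exact key _ (List.nodup_finRange _)

/-- The forms annihilated by all creation operators are the multiples of `topZ`. -/
theorem exists_smul_topZ {y : CForm M} (hy : ∀ p, creation v p y = 0) :
    ∃ z : ℂ, y = z • topZ v := by
  have key : ∀ l : List (Fin (s + 1)), l.Nodup → ∃ w, y = creationProd v l w ∧
      (∀ j ∈ l, annihilation v (Sum.inl j) w = 0) ∧ (∀ j, creation v (Sum.inr j) w = 0) ∧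
      ∀ j ∉ l, creation v (Sum.inl j) w = 0 := by
    intro l hl
    -- Since `c_j w = 0`, the relations give `w = c_j (d_j w)`: the factor `z_j` is split off next
    -- to `w`, at the right end of the product.
    induction l using List.reverseRecOn with
    | nil => exact ⟨y, rfl, by simp, fun j => hy _, fun j _ => hy _⟩
    | append_singleton l j ih =>
      rw [List.nodup_append] at hl
      have hjl : j ∉ l := fun hj => hl.2.2 j hj j (by simp) rfl
      obtain ⟨w, h1, h2, h3, h4⟩ := ih hl.1
      refine ⟨annihilation v (Sum.inl j) w, ?_, ?_, ?_, ?_⟩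
      · have h5 := (isCAR v).d_c_self (Sum.inl j) w
        rw [h4 j hjl, map_zero, eq_comm, sub_eq_zero] at h5
        rw [creationProd_concat, ← h5, h1]
      · intro k hk
        rcases List.mem_append.1 hk with hk | hk
        · rw [(isCAR v).d_d, h2 k hk, map_zero, neg_zero]
        · rw [List.mem_singleton.1 hk, (isCAR v).d_d_self]
      · intro k
        have h5 := (isCAR v).d_c_of_ne (p := Sum.inl j) (q := Sum.inr k) (by simp) w
        rw [h3, map_zero] at h5
        exact neg_eq_zero.1 h5.symm
      · intro k hk
        rw [List.mem_append, not_or, List.mem_singleton] at hk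
        have h5 := (isCAR v).d_c_of_ne (p := Sum.inl j) (q := Sum.inl k)
          (by simpa using Ne.symm hk.2) w
        rw [h4 k hk.1, map_zero] at h5
        exact neg_eq_zero.1 h5.symm
  obtain ⟨w, h1, h2, h3, -⟩ := key _ (List.nodup_finRange _)
  -- The remaining `w` is killed by both combinations of `I_{1j}` and `± i I_{2j}`, hence by every
  -- contraction, so it is a scalar.
  obtain ⟨z, rfl⟩ := exists_smul_one_of_I_baseChange_eq_zero v (x := w) (by
    intro i j
    have e1 := h2 j (List.mem_finRange j)
    have e2 := h3 j
    simp only [annihilation, creation, Sum.elim_inl, Sum.elim_inr, contractC, LinearMap.smul_apply,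
      LinearMap.add_apply] at e1 e2
    generalize hA : (I v 0 j).baseChange ℂ w = A at e1 e2
    generalize hB : (I v 1 j).baseChange ℂ w = B at e1 e2
    fin_cases i
    · refine hA.trans ?_
      calc A = (1 / 2 : ℂ) • (A + -Complex.I • B) + (1 / 2 : ℂ) • (A + Complex.I • B) := by module
        _ = 0 := by rw [e1, e2, add_zero]
    · refine hB.trans ((smul_eq_zero.1 (?_ : Complex.I • B = 0)).resolve_left Complex.I_ne_zero)
      calc Complex.I • B =
          (1 / 2 : ℂ) • (A + Complex.I • B) - (1 / 2 : ℂ) • (A + -Complex.I • B) := by module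
        _ = 0 := by rw [e1, e2, sub_zero])
  exact ⟨z, by rw [h1, map_smul]; rfl⟩

/-! ### The Gram matrix of the weight space -/

theorem conj_wedgeC (z : ℂ) (j : Fin (s + 1)) (x : CForm M) :
    conj (wedgeC v z j x) = wedgeC v (starRingEnd ℂ z) j (conj x) := by
  simp only [wedgeC, LinearMap.add_apply, LinearMap.smul_apply, map_add, map_smulₛₗ,
    conj_baseChange]

theorem conj_contractC (z : ℂ) (j : Fin (s + 1)) (x : CForm M) :
    conj (contractC v z j x) = contractC v (starRingEnd ℂ z) j (conj x) := by
  simp only [contractC, LinearMap.add_apply, LinearMap.smul_apply, map_add, map_smulₛₗ,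
    conj_baseChange]

/-- An odd operator exchanges even and odd forms, so the phase moves from one parity to the other;
`phase ^ 2 = -1` lets the discrepancy be written as a scalar times the involution. -/
theorem apply_parityScale_phase {T : Module.End ℂ (CForm M)}
    (hT : ∀ x, invol (T x) = -T (invol x)) (x : CForm M) :
    T (parityScale (phase s) x) = phase s • invol (parityScale (phase s) (T x)) := by
  simp only [parityScale_apply, map_add, map_smul, map_neg, invol_invol, hT, smul_add, smul_neg,
    smul_smul, neg_neg]
  have h := phase_mul_self (s := s)
  match_scalars
  · linear_combination (1 / 2) * h
  · linear_combination (1 / 2) * h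

theorem invol_wedgeC (z : ℂ) (j : Fin (s + 1)) (x : CForm M) :
    invol (wedgeC v z j x) = -wedgeC v z j (invol x) := by
  simp only [wedgeC, LinearMap.add_apply, LinearMap.smul_apply, map_add, map_smul,
    invol_E_baseChange, smul_neg, neg_add]

theorem invol_contractC (z : ℂ) (j : Fin (s + 1)) (x : CForm M) :
    invol (contractC v z j x) = -contractC v z j (invol x) := by
  simp only [contractC, LinearMap.add_apply, LinearMap.smul_apply, map_add, map_smul,
    invol_I_baseChange, smul_neg, neg_add]

theorem form_wedgeC (z : ℂ) (j : Fin (s + 1)) (α β : CForm M) :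
    form v (wedgeC v z j α) β = phase s * form v α (wedgeC v (starRingEnd ℂ z) j β) := by
  have h : ∀ x y, tau v (wedgeC v z j x * y) = tau v (invol x * wedgeC v z j y) := by
    intro x y
    simp only [wedgeC, LinearMap.add_apply, LinearMap.smul_apply, add_mul, mul_add,
      smul_mul_assoc, mul_smul_comm, map_add, map_smul, tau_E_mul]
  rw [form_eq, form_eq, h, apply_parityScale_phase (invol_wedgeC v z j), mul_smul_comm, map_smul,
    ← map_mul, tau_invol, conj_wedgeC, Complex.conj_conj, smul_eq_mul]

theorem form_contractC (z : ℂ) (j : Fin (s + 1)) (α β : CForm M) :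
    form v (contractC v z j α) β = -(phase s * form v α (contractC v (starRingEnd ℂ z) j β)) := by
  have h : ∀ x y, tau v (contractC v z j x * y) = -tau v (invol x * contractC v z j y) := by
    intro x y
    simp only [contractC, LinearMap.add_apply, LinearMap.smul_apply, add_mul, mul_add,
      smul_mul_assoc, mul_smul_comm, map_add, map_smul, tau_I_mul, smul_neg, neg_add]
  rw [form_eq, form_eq, h, apply_parityScale_phase (invol_contractC v z j), mul_smul_comm,
    map_smul, ← map_mul, tau_invol, conj_contractC, Complex.conj_conj, smul_eq_mul]

/-- The sign in the adjunction of creation and annihilation operators. -/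
def adjSign : Fin (s + 1) ⊕ Fin (s + 1) → ℂ := Sum.elim (fun _ => 1) fun _ => -1

theorem adjSign_mul_self (p : Fin (s + 1) ⊕ Fin (s + 1)) : adjSign p * adjSign p = 1 := by
  rcases p with j | j <;> simp [adjSign]

/-- Conjugation turns `z_j` into `conj z_j`, whose wedge and contraction belong to the other summand
with creation and annihilation exchanged; hence `p.swap`. -/
theorem form_creation (p : Fin (s + 1) ⊕ Fin (s + 1)) (α β : CForm M) :
    form v (creation v p α) β = adjSign p * phase s * form v α (annihilation v p.swap β) := by
  have h2 : starRingEnd ℂ 2 = 2 := Complex.conj_ofNat 2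
  rcases p with j | j
  · simp [creation, annihilation, adjSign, form_wedgeC]
  · simp [creation, annihilation, adjSign, form_contractC, h2]
    ring

theorem form_annihilation (p : Fin (s + 1) ⊕ Fin (s + 1)) (α β : CForm M) :
    form v (annihilation v p α) β =
      -(adjSign p * phase s * form v α (creation v p.swap β)) := by
  have h2 : starRingEnd ℂ 2 = 2 := Complex.conj_ofNat 2
  rcases p with j | j
  · simp [creation, annihilation, adjSign, form_contractC, h2]
    ring
  · simp [creation, annihilation, adjSign, form_wedgeC]

theorem form_annihilation_topZ (p q : Fin (s + 1) ⊕ Fin (s + 1)) :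
    form v (annihilation v p (topZ v)) (annihilation v q (topZ v)) =
      if p.swap = q then -(adjSign p * phase s * form v (topZ v) (topZ v)) else 0 := by
  rw [form_annihilation]
  split_ifs with h
  · have h1 := (isCAR v).d_c_self q (topZ v)
    rw [creation_topZ, map_zero, eq_comm, sub_eq_zero] at h1
    rw [h, ← h1]
  · have h1 := (isCAR v).d_c_of_ne (Ne.symm h) (topZ v)
    rw [creation_topZ, map_zero] at h1
    rw [neg_eq_zero.1 h1.symm]
    simp

/-- `Z = c d Z` at the index `p.swap`, and moving both operators across the form gives `c d` at `p`,
the signs and phases multiplying to `1`. -/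
theorem form_topZ_number (p : Fin (s + 1) ⊕ Fin (s + 1)) (β : CForm M) :
    form v (topZ v) β = form v (topZ v) (creation v p (annihilation v p β)) := by
  have h1 := (isCAR v).d_c_self p.swap (topZ v)
  rw [creation_topZ, map_zero, eq_comm, sub_eq_zero] at h1
  conv_lhs => rw [h1]
  rw [form_creation, form_annihilation, Sum.swap_swap]
  linear_combination (-(phase s * phase s) * form v (topZ v)
    (creation v p (annihilation v p β))) * adjSign_mul_self p.swap -
      form v (topZ v) (creation v p (annihilation v p β)) * phase_mul_self (s := s)

/-- Replacing `β` by `c_p d_p β` for every `p` does not change `⟨Z, β⟩` and ends at a form killed by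
all `c_p`, a multiple of `Z`. If `⟨Z, Z⟩` vanished, `Z` would lie in the radical. -/
theorem form_topZ_topZ_ne_zero : form v (topZ v) (topZ v) ≠ 0 := by
  intro h0
  refine topZ_notMem_radical v (mem_radical_of_form_eq_zero v fun β => ?_)
  have key : ∀ S : Finset (Fin (s + 1) ⊕ Fin (s + 1)), ∃ γ, (∀ p ∈ S, creation v p γ = 0) ∧
      form v (topZ v) β = form v (topZ v) γ := by
    intro S
    induction S using Finset.induction_on with
    | empty => exact ⟨β, by simp, rfl⟩
    | insert p S hp ih =>
      obtain ⟨γ, h1, h2⟩ := ih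
      refine ⟨creation v p (annihilation v p γ), fun q hq => ?_, by rw [h2, ← form_topZ_number]⟩
      by_cases hqp : q = p
      · rw [hqp, (isCAR v).c_c_self]
      · have hq' := h1 q ((Finset.mem_insert.1 hq).resolve_left hqp)
        have h3 := (isCAR v).d_c_of_ne (Ne.symm hqp) γ
        rw [hq', map_zero] at h3
        rw [(isCAR v).c_c, neg_eq_zero.1 h3.symm, map_zero, neg_zero]
  obtain ⟨γ, h1, h2⟩ := key Finset.univ
  obtain ⟨z, rfl⟩ := exists_smul_topZ v fun p => h1 p (Finset.mem_univ p)
  rw [h2, map_smulₛₗ, h0, smul_zero]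

/-- Turns the `J`-weight into the hole number: `J = -is` means `∑ d_p c_p = 1`. -/
theorem I_smul_J : Complex.I • (J v).baseChange ℂ =
    ((s : ℂ) + 1) • 1 - ∑ p, annihilation v p * creation v p := by
  have h : ∀ j, annihilation v (Sum.inl j) * creation v (Sum.inl j) +
      annihilation v (Sum.inr j) * creation v (Sum.inr j) =
      1 - Complex.I • (E v 1 j * I v 0 j - E v 0 j * I v 1 j).baseChange ℂ := by
    intro j
    rw [(isCAR v).dc]
    simp only [creation, annihilation, Sum.elim_inl, Sum.elim_inr, wedgeC, contractC, if_true,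
      LinearMap.baseChange_sub, LinearMap.baseChange_mul, mul_add, add_mul, smul_mul_assoc,
      mul_smul_comm]
    module
  have hJ : (J v).baseChange ℂ =
      ∑ j, (E v 1 j * I v 0 j - E v 0 j * I v 1 j).baseChange ℂ := by
    refine LinearMap.ext fun x => ?_
    simp only [J]
    exact congrArg (fun T => T x) (map_sum (LinearMap.baseChangeHom ℝ ℂ (RForm M) (RForm M)) _ _)
  rw [Fintype.sum_sum_type, ← Finset.sum_add_distrib]
  have hn : ∑ _j : Fin (s + 1), (1 : Module.End ℂ (CForm M)) = ((s : ℂ) + 1) • 1 := by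
    rw [Finset.sum_const, Finset.card_univ, Fintype.card_fin, ← Nat.cast_smul_eq_nsmul ℂ]
    push_cast
    rfl
  simp only [h, Finset.sum_sub_distrib, ← Finset.smul_sum, ← hJ, hn]
  abel

theorem mem_weightSpace_iff (x : CForm M) :
    x ∈ weightSpace v ↔ ∑ p, annihilation v p (creation v p x) = x := by
  have h := LinearMap.congr_fun (I_smul_J v) x
  simp only [LinearMap.smul_apply, LinearMap.sub_apply, LinearMap.sum_apply,
    Module.End.mul_apply, Module.End.one_apply] at h
  rw [weightSpace, Module.End.mem_eigenspace_iff]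
  constructor
  · intro hx
    rw [hx, smul_smul] at h
    have e : Complex.I * (-(s : ℂ) * Complex.I) = s := by
      linear_combination (-(s : ℂ)) * Complex.I_sq
    rw [e, add_smul, one_smul] at h
    have h2 := sub_eq_zero.2 h
    rw [← sub_eq_zero, ← h2]
    abel
  · intro hx
    rw [hx, add_smul, one_smul, add_sub_cancel_right] at h
    have h2 := congrArg (fun y => (-Complex.I) • y) h
    simp only [smul_smul] at h2
    simpa [mul_comm] using h2

/-- A form with one hole is a sum of `d_p y_p` with every `y_p` killed by all `c_q`, hence a
multiple of `Z`. -/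
theorem weightSpace_eq_span :
    weightSpace v = Submodule.span ℂ (Set.range fun p => annihilation v p (topZ v)) := by
  refine le_antisymm (fun x hx => ?_) (Submodule.span_le.2 ?_)
  · obtain ⟨y, hy, rfl⟩ := (isCAR v).exists_sum_of_sum_eq_self ((mem_weightSpace_iff v x).1 hx)
    refine Submodule.sum_mem _ fun p _ => ?_
    obtain ⟨z, hz⟩ := exists_smul_topZ v (hy p)
    rw [hz, map_smul]
    exact Submodule.smul_mem _ _ (Submodule.subset_span ⟨p, rfl⟩)
  · rintro _ ⟨p, rfl⟩
    refine (mem_weightSpace_iff v _).2 ?_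
    rw [Finset.sum_eq_single p]
    · have h1 := (isCAR v).d_c_self p (annihilation v p (topZ v))
      rwa [(isCAR v).d_d_self, map_zero, sub_zero] at h1
    · intro q _ hqp
      have h1 := (isCAR v).d_c_of_ne (Ne.symm hqp) (topZ v)
      rw [creation_topZ, map_zero] at h1
      rw [neg_eq_zero.1 h1.symm, map_zero]
    · simp

/-- The Hermitian form has signature `(s + 1, s + 1)` on the weight space. -/
theorem hasSignature_weightSpace : HasSignature (form v) (weightSpace v) (s + 1) (s + 1) := by
  set e : Fin (s + 1) ⊕ Fin (s + 1) → CForm M := fun p => annihilation v p (topZ v) with he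
  set κ : ℂ := -(phase s * form v (topZ v) (topZ v)) with hκ
  have hφ : phase s ≠ 0 := by
    intro h
    have h1 := phase_mul_self (s := s)
    rw [h] at h1
    simp at h1
  have hκ0 : κ ≠ 0 := neg_ne_zero.2 (mul_ne_zero hφ (form_topZ_topZ_ne_zero v))
  have g1 : ∀ j k, form v (e (Sum.inl j)) (e (Sum.inl k)) = 0 := fun j k => by
    simp [he, form_annihilation_topZ]
  have g2 : ∀ j k, form v (e (Sum.inr j)) (e (Sum.inr k)) = 0 := fun j k => by
    simp [he, form_annihilation_topZ]
  have g3 : ∀ j k, form v (e (Sum.inl j)) (e (Sum.inr k)) = if j = k then κ else 0 :=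
    fun j k => by simp [he, form_annihilation_topZ, adjSign, hκ]
  have g4 : ∀ j k, form v (e (Sum.inr j)) (e (Sum.inl k)) =
      if j = k then starRingEnd ℂ κ else 0 := fun j k => by
    rw [form_hermitian, g3]
    simp only [eq_comm (a := k)]
    split_ifs <;> simp
  -- Scales each hyperbolic pair so that `e_j ± c e'_j` have norms `conj c * κ + c * conj κ = 1` and
  -- its negative, and are orthogonal to each other.
  set c : ℂ := starRingEnd ℂ (1 / (2 * κ)) with hc
  have hcκ : starRingEnd ℂ c * κ = 1 / 2 := by
    rw [hc, Complex.conj_conj]; field_simp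
  have hcκ' : c * starRingEnd ℂ κ = 1 / 2 := by
    have h := congrArg (starRingEnd ℂ) hcκ
    rw [map_mul, Complex.conj_conj] at h
    rw [h, map_div₀, map_one, Complex.conj_ofNat]
  have hc0 : c ≠ 0 := by
    intro h
    rw [h, zero_mul] at hcκ'
    norm_num at hcκ'
  set b : Fin (s + 1) ⊕ Fin (s + 1) → CForm M :=
    Sum.elim (fun j => e (Sum.inl j) + c • e (Sum.inr j))
      (fun j => e (Sum.inl j) - c • e (Sum.inr j)) with hb
  have hspan : weightSpace v = Submodule.span ℂ (Set.range b) := by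
    rw [weightSpace_eq_span]
    refine le_antisymm (Submodule.span_le.2 ?_) (Submodule.span_le.2 ?_)
    · have hl : ∀ j, b (Sum.inl j) ∈ Submodule.span ℂ (Set.range b) :=
        fun j => Submodule.subset_span ⟨_, rfl⟩
      have hr : ∀ j, b (Sum.inr j) ∈ Submodule.span ℂ (Set.range b) :=
        fun j => Submodule.subset_span ⟨_, rfl⟩
      rintro _ ⟨j | j, rfl⟩
      · have h : e (Sum.inl j) = (1 / 2 : ℂ) • (b (Sum.inl j) + b (Sum.inr j)) := by
          simp only [hb, Sum.elim_inl, Sum.elim_inr]; module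
        change e (Sum.inl j) ∈ _
        rw [h]
        exact Submodule.smul_mem _ _ (add_mem (hl j) (hr j))
      · have h : e (Sum.inr j) = (c⁻¹ / 2 : ℂ) • (b (Sum.inl j) - b (Sum.inr j)) := by
          simp only [hb, Sum.elim_inl, Sum.elim_inr]
          match_scalars <;> field_simp <;> ring
        change e (Sum.inr j) ∈ _
        rw [h]
        exact Submodule.smul_mem _ _ (sub_mem (hl j) (hr j))
    · have hmem : ∀ p, e p ∈ Submodule.span ℂ (Set.range e) :=
        fun p => Submodule.subset_span ⟨_, rfl⟩
      rintro _ ⟨j | j, rfl⟩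
      · exact add_mem (hmem _) (Submodule.smul_mem _ _ (hmem _))
      · exact sub_mem (hmem _) (Submodule.smul_mem _ _ (hmem _))
  rw [hspan]
  refine hasSignature_span ?_
  rintro (j | j) (k | k) <;>
    simp only [hb, Sum.elim_inl, Sum.elim_inr, map_add, map_sub, LinearMap.add_apply,
      LinearMap.sub_apply, map_smul, map_smulₛₗ, LinearMap.smul_apply, smul_eq_mul, g1, g2, g3, g4,
      LieAlgebra.Orthogonal.indefiniteDiagonal, Matrix.diagonal_apply, Sum.inl.injEq,
      Sum.inr.injEq, reduceCtorEq, if_false] <;>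
    by_cases hjk : j = k <;>
    simp only [hjk, if_true, if_false] <;>
    first
      | linear_combination hcκ + hcκ'
      | linear_combination hcκ' - hcκ
      | linear_combination hcκ - hcκ'
      | linear_combination -hcκ - hcκ'
      | ring

end Signature

end SKaehler

end

theorem mainTheorem4 (s : ℕ) (hs : 2 ≤ s) (X : Type*) [TopologicalSpace X]
    [ChartedSpace (EuclideanSpace ℝ (Fin (2 * (s + 1)))) X]
    [IsManifold (𝓡 (2 * (s + 1))) ∞ X]
    [RiemannianBundle (fun p : X => TangentSpace (𝓡 (2 * (s + 1))) p)]
    [IsContMDiffRiemannianBundle (𝓡 (2 * (s + 1))) ∞ (EuclideanSpace ℝ (Fin (2 * (s + 1))))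
      (fun p : X => TangentSpace (𝓡 (2 * (s + 1))) p)]
    (S : SKaehler.Structure s X) (p : X)
    (v : OrthonormalBasis (Fin 2 × Fin (s + 1)) ℝ (SKaehler.Cotangent s p))
    (hv : SKaehler.IsAdapted (fun j k => S.form j k p) v) :
    SKaehler.IsRealForm (SKaehler.uL v) (SKaehler.LC v) ∧
    (∀ α β, SKaehler.form v β α = starRingEnd ℂ (SKaehler.form v α β)) ∧
    (SKaehler.uL v : Set (Module.End ℂ (SKaehler.CForm (SKaehler.Cotangent s p)))) =
      {φ | φ ∈ SKaehler.LC v ∧ SKaehler.Preserves (SKaehler.form v) φ} ∧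
    SKaehler.HasSignature (SKaehler.form v) (SKaehler.weightSpace v) (s + 1) (s + 1) ∧
    Nonempty (SKaehler.uL v ≃ₗ⁅ℝ⁆ SKaehler.su (s + 1) (s + 1)) :=
  ⟨SKaehler.isRealForm_uL v hs, SKaehler.form_hermitian v, SKaehler.uL_eq_preserves v hs,
    SKaehler.hasSignature_weightSpace v, SKaehler.nonempty_uL_equiv_su v hs⟩
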